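/- Let $b\ge 2$ be an integer and let $\lambda_b$ be the unique zero in $(1/b,1)$ of the function $$h_b(\lambda)=\begin{cases}\dfrac{1}{4\lambda^2(2\lambda-1)^2}+\dfrac{1}{16\lambda^2(4\lambda-1)^2}-\dfrac{5}{64\lambda^2}+\dfrac{\sqrt2}{2\lambda}-1,& b=2,\\[2mm] \dfrac{1}{(b\lambda-1)^2}+\dfrac{1}{(b^2\lambda-1)^2}-\sin^2\!\left(\dfrac{\pi}{b}\right),& b\ge3.\end{cases}$$ Let $\lambda\in(\lambda_b,1)$ and $\gamma=\frac1{b\lambda}$. Let $B(\xi,x)=\bigl(b\xi \bmod 1,\ \frac{x+\lfloor b\xi\rfloor}{b}\bigr)$ be the $b$-baker map on $[0,1)^2$, let $x_n$ denote the second coordinate of $B^n(\xi,x)$, let $s(t)=\frac{\sin(\pi t)}{t/2}$ for $t\neq0$ and $s(0)=2\pi$, and put $$\Theta_z(\xi,x)=\sum_{n=1}^\infty\gamma^n\, s\!\left(\frac{z}{b^n}\right)\sin\!\left(2\pi\Bigl(x_n+\frac{z}{2b^n}\Bigr)\right).$$ Write $m^2$ for Lebesgue measure on $[0,1)^2$.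 For every $\eta\in(0,1]$ there are $\delta\in(0,\eta)$ and $C>0$ such that for every $r\in(0,1)$ there is a measurable set $E_r\subset[0,1)^2$ with $m^2(E_r)\le C r^\delta$ and the following property: for every $z\in[-1,1]\setminus\{0\}$ and every family $(\mathcal L_x)_{x\in[0,1)}$ of intervals of length $\frac{2r}{|z|}$ whose end points depend measurably on $x$, $$m^2\bigl\{(\xi,x)\in[0,1)^2\setminus E_r:\ \Theta_z(\xi,x)\in\mathcal L_x\bigr\}\le C\,r^{1-2\eta}\,|z|^{-(1-\eta)}.$$ -/

import Mathlib

open MeasureTheory Set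

namespace Weierstrass

/-- The function `h_b` whose zero in `(1/b, 1)` is the critical parameter `λ_b`. -/
noncomputable def hFun (b : ℕ) (l : ℝ) : ℝ :=
  if b = 2 then
    1 / (4 * l ^ 2 * (2 * l - 1) ^ 2) + 1 / (16 * l ^ 2 * (4 * l - 1) ^ 2)
      - 5 / (64 * l ^ 2) + √2 / (2 * l) - 1
  else
    1 / ((b : ℝ) * l - 1) ^ 2 + 1 / ((b : ℝ) ^ 2 * l - 1) ^ 2 - Real.sin (Real.pi / b) ^ 2

theorem hFun_strictAntiOn (b : ℕ) (hb : 2 ≤ b) :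
    StrictAntiOn (hFun b) (Ioc (1 / (b : ℝ)) 1) := by
  have hb' : (2 : ℝ) ≤ b := by exact_mod_cast hb
  have hb0 : (0 : ℝ) < b := by linarith
  rintro x ⟨hx, hx1⟩ y ⟨hy, hy1⟩ hxy
  by_cases h2 : b = 2
  · subst h2
    norm_num at hx hy
    simp only [hFun, if_true]
    have hx0 : 0 < x := by linarith
    have hy0 : 0 < y := by linarith
    have e1 : 1 / (4 * y ^ 2 * (2 * y - 1) ^ 2) < 1 / (4 * x ^ 2 * (2 * x - 1) ^ 2) := by
      have : 0 < 2 * x - 1 := by linarith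
      apply one_div_lt_one_div_of_lt (by positivity)
      gcongr
    have e2 : 1 / (16 * y ^ 2 * (4 * y - 1) ^ 2) < 1 / (16 * x ^ 2 * (4 * x - 1) ^ 2) := by
      have : 0 < 4 * x - 1 := by linarith
      apply one_div_lt_one_div_of_lt (by positivity)
      gcongr
    have e3 : -(5 / (64 * y ^ 2)) + √2 / (2 * y) ≤ -(5 / (64 * x ^ 2)) + √2 / (2 * x) := by
      have hs : (1 : ℝ) ≤ √2 := by
        rw [Real.one_le_sqrt]; norm_num
      have hd : (-(5 / (64 * x ^ 2)) + √2 / (2 * x)) - (-(5 / (64 * y ^ 2)) + √2 / (2 * y))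
          = (y - x) * (32 * √2 * (x * y) - 5 * (x + y)) / (64 * x ^ 2 * y ^ 2) := by
        field_simp; ring
      have h1 : 0 ≤ 32 * √2 * (x * y) - 5 * (x + y) := by
        have : 32 * (x * y) ≤ 32 * √2 * (x * y) := by
          have := mul_pos hx0 hy0
          nlinarith
        nlinarith
      have : 0 ≤ (y - x) * (32 * √2 * (x * y) - 5 * (x + y)) / (64 * x ^ 2 * y ^ 2) := by
        apply div_nonneg (mul_nonneg (by linarith) h1) (by positivity)
      linarith
    linarith
  · simp only [hFun, if_neg h2]
    rw [div_lt_iff₀ hb0] at hx hy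
    have p1 : 0 < (b : ℝ) * x - 1 := by linarith
    have p2 : 0 < (b : ℝ) ^ 2 * x - 1 := by nlinarith
    have e1 : 1 / ((b : ℝ) * y - 1) ^ 2 < 1 / ((b : ℝ) * x - 1) ^ 2 := by
      apply one_div_lt_one_div_of_lt (by positivity)
      gcongr
    have e2 : 1 / ((b : ℝ) ^ 2 * y - 1) ^ 2 < 1 / ((b : ℝ) ^ 2 * x - 1) ^ 2 := by
      apply one_div_lt_one_div_of_lt (by positivity)
      gcongr
    linarith

theorem hFun_one_neg (b : ℕ) (hb : 2 ≤ b) : hFun b 1 < 0 := by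
  by_cases h2 : b = 2
  · subst h2
    simp only [hFun, if_true]
    have : √2 < 3 / 2 := by
      rw [Real.sqrt_lt' (by norm_num)]; norm_num
    norm_num
    linarith
  · have hb3 : (3 : ℝ) ≤ b := by
      have : 3 ≤ b := by omega
      exact_mod_cast this
    have hb0 : (0 : ℝ) < b := by linarith
    simp only [hFun, if_neg h2, mul_one]
    have hs : 2 / (b : ℝ) ≤ Real.sin (Real.pi / b) := by
      have h := Real.mul_le_sin (x := Real.pi / b) (by positivity)
        (by gcongr; linarith)
      have e : 2 / Real.pi * (Real.pi / b) = 2 / (b : ℝ) := by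
        field_simp
      rwa [e] at h
    have hs2 : (2 / (b : ℝ)) ^ 2 ≤ Real.sin (Real.pi / b) ^ 2 := by gcongr
    have e1 : 1 / ((b : ℝ) - 1) ^ 2 ≤ 1 / (2 / 3 * (b : ℝ)) ^ 2 := by
      apply one_div_le_one_div_of_le (by positivity)
      gcongr
      linarith
    have e2 : 1 / ((b : ℝ) ^ 2 - 1) ^ 2 ≤ 1 / (b : ℝ) ^ 2 := by
      apply one_div_le_one_div_of_le (by positivity)
      gcongr
      nlinarith
    have e3 : 1 / (2 / 3 * (b : ℝ)) ^ 2 + 1 / (b : ℝ) ^ 2 < (2 / (b : ℝ)) ^ 2 := by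
      have : (2 / (b : ℝ)) ^ 2 - (1 / (2 / 3 * (b : ℝ)) ^ 2 + 1 / (b : ℝ) ^ 2)
          = 3 / 4 * (1 / (b : ℝ) ^ 2) := by
        field_simp; norm_num
      have h0 : 0 < 3 / 4 * (1 / (b : ℝ) ^ 2) := by positivity
      linarith
    linarith

theorem hFun_continuousOn (b : ℕ) (hb : 2 ≤ b) :
    ContinuousOn (hFun b) (Ioc (1 / (b : ℝ)) 1) := by
  have hb' : (2 : ℝ) ≤ b := by exact_mod_cast hb
  have hb0 : (0 : ℝ) < b := by linarith
  rintro x ⟨hx, hx1⟩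
  apply ContinuousAt.continuousWithinAt
  by_cases h2 : b = 2
  · subst h2
    norm_num at hx
    have hx0 : 0 < x := by linarith
    have p1 : 0 < 2 * x - 1 := by linarith
    have p2 : 0 < 4 * x - 1 := by linarith
    unfold hFun
    simp only [if_true]
    have q1 : 4 * x ^ 2 * (2 * x - 1) ^ 2 ≠ 0 := by positivity
    have q2 : 16 * x ^ 2 * (4 * x - 1) ^ 2 ≠ 0 := by positivity
    have q3 : 64 * x ^ 2 ≠ 0 := by positivity
    have q4 : 2 * x ≠ 0 := by positivity
    fun_prop (disch := assumption)
  · rw [div_lt_iff₀ hb0] at hx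
    have p1 : 0 < (b : ℝ) * x - 1 := by linarith
    have p2 : 0 < (b : ℝ) ^ 2 * x - 1 := by nlinarith
    unfold hFun
    simp only [if_neg h2]
    have q1 : ((b : ℝ) * x - 1) ^ 2 ≠ 0 := by positivity
    have q2 : ((b : ℝ) ^ 2 * x - 1) ^ 2 ≠ 0 := by positivity
    fun_prop (disch := assumption)

theorem exists_hFun_pos (b : ℕ) (hb : 2 ≤ b) :
    ∃ l ∈ Ioo (1 / (b : ℝ)) 1, 0 < hFun b l := by
  have hb' : (2 : ℝ) ≤ b := by exact_mod_cast hb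
  have hb0 : (0 : ℝ) < b := by linarith
  by_cases h2 : b = 2
  · subst h2
    refine ⟨3 / 4, by norm_num, ?_⟩
    have hs : (1 : ℝ) ≤ √2 := by
      rw [Real.one_le_sqrt]; norm_num
    simp only [hFun, if_true]
    norm_num
    linarith
  · have hb3 : (3 : ℝ) ≤ b := by
      have : 3 ≤ b := by omega
      exact_mod_cast this
    refine ⟨3 / (2 * b), ⟨?_, ?_⟩, ?_⟩
    · rw [div_lt_div_iff₀ hb0 (by positivity)]; linarith
    · rw [div_lt_one (by positivity)]; linarith
    · simp only [hFun, if_neg h2]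
      have e : (b : ℝ) * (3 / (2 * b)) - 1 = 1 / 2 := by field_simp; norm_num
      rw [e]
      have h1 : 0 ≤ 1 / ((b : ℝ) ^ 2 * (3 / (2 * b)) - 1) ^ 2 := by positivity
      have h3 := Real.sin_sq_le_one (Real.pi / b)
      have h4 : 1 / (1 / 2 : ℝ) ^ 2 = 4 := by norm_num
      linarith

/-- `h_b` has exactly one zero in `(1/b, 1)`. -/
theorem existsUnique_zero (b : ℕ) (hb : 2 ≤ b) :
    ∃! l : ℝ, l ∈ Ioo (1 / (b : ℝ)) 1 ∧ hFun b l = 0 := by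
  obtain ⟨a, ⟨ha, ha1⟩, hpos⟩ := exists_hFun_pos b hb
  have hcont : ContinuousOn (hFun b) (Icc a 1) :=
    (hFun_continuousOn b hb).mono fun x hx => ⟨ha.trans_le hx.1, hx.2⟩
  obtain ⟨c, ⟨hc, hc1⟩, hz⟩ :=
    intermediate_value_Ioo' ha1.le hcont ⟨hFun_one_neg b hb, hpos⟩
  refine ⟨c, ⟨⟨ha.trans hc, hc1⟩, hz⟩, ?_⟩
  rintro y ⟨⟨hy, hy1⟩, hyz⟩
  exact (hFun_strictAntiOn b hb).injOn ⟨hy, hy1.le⟩ ⟨ha.trans hc, hc1.le⟩ (hyz.trans hz.symm)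

/-- The critical parameter `λ_b`: the unique zero of `h_b` in `(1/b, 1)`. -/
noncomputable def lambdaCrit (b : ℕ) (hb : 2 ≤ b) : ℝ :=
  (existsUnique_zero b hb).choose

theorem lambdaCrit_spec (b : ℕ) (hb : 2 ≤ b) :
    lambdaCrit b hb ∈ Ioo (1 / (b : ℝ)) 1 ∧ hFun b (lambdaCrit b hb) = 0 :=
  (existsUnique_zero b hb).choose_spec.1

/-- The unit square `[0,1)²`. -/
def unitSquare : Set (ℝ × ℝ) := Ico 0 1 ×ˢ Ico 0 1

/-- The `b`-baker map `B(ξ, x) = (bξ mod 1, (x + k(ξ)) / b)`, where `k(ξ) = j` for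
`ξ ∈ [j/b, (j+1)/b)`, that is, `k(ξ) = ⌊bξ⌋`. -/
noncomputable def baker (b : ℕ) (p : ℝ × ℝ) : ℝ × ℝ :=
  (Int.fract ((b : ℝ) * p.1), (p.2 + (⌊(b : ℝ) * p.1⌋ : ℝ)) / b)

/-- `x_n`: the second coordinate of `B^n(ξ, x)`. -/
noncomputable def orbitX (b n : ℕ) (p : ℝ × ℝ) : ℝ := ((baker b)^[n] p).2

/-- `s(t) = (t/2)⁻¹ sin(2π t/2)`, extended continuously by `s(0) = 2π`. -/
noncomputable def sFun (t : ℝ) : ℝ :=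
  if t = 0 then 2 * Real.pi else (t / 2)⁻¹ * Real.sin (2 * Real.pi * (t / 2))

/-- `Θ_z(ξ, x) = ∑_{n ≥ 1} γ^n s(z / b^n) sin(2π (x_n + z / (2 b^n)))` with `γ = 1 / (b λ)`. -/
noncomputable def Theta (b : ℕ) (lam z : ℝ) (p : ℝ × ℝ) : ℝ :=
  ∑' n : ℕ, (1 / ((b : ℝ) * lam)) ^ (n + 1) * sFun (z / (b : ℝ) ^ (n + 1)) *
    Real.sin (2 * Real.pi * (orbitX b (n + 1) p + z / (2 * (b : ℝ) ^ (n + 1))))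

/-- `(L x)`, for `x ∈ [0,1)`, is a family of intervals of length `len` whose end points
`a x` and `a x + len` depend (Lebesgue) measurably on `x`; each interval may or may not
contain its end points. -/
def IsMeasurableIntervalFamily (L : ℝ → Set ℝ) (len : ℝ) : Prop :=
  ∃ a : ℝ → ℝ, AEMeasurable a (volume.restrict (Ico (0 : ℝ) 1)) ∧
    ∀ x ∈ Ico (0 : ℝ) 1, Ioo (a x) (a x + len) ⊆ L x ∧ L x ⊆ Icc (a x) (a x + len)

end Weierstrass

/-!
Write `γ = 1 / (b λ)`. The exceptional set must not depend on `z`, so second moment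
estimates for each single `Θ_z` do not suffice; the point is that an estimate for `z = 0` alone
can be transported to all `z ∈ [-1, 1]` by the self-affinity of `Θ`.

*Transversality at `z = 0`.* The condition `h_b(λ) < 0`, which holds to the right of `λ_b`, says
that the first digit (for `b = 2`, the first two digits) dominates the rest of the series. Hence
for `ξ`, `ξ'` with different first digits the function `D(x) = Θ_0(ξ, x) - Θ_0(ξ', x)` and its
derivative are not small at the same point (`transversality`), and `|D| ≤ R` on a set of measure
`O(R)` (`exists_volume_close_le`). If the first digits agree, then the baker map magnifies the
difference by `1 / γ`. Since a common digit has probability `1 / b` and `b γ = 1 / λ > 1`, the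
probability that `Θ_0(ξ, x)` and `Θ_0(ξ', x)` are `R`-close is `O(R)` (`exists_pairCorr_le`). By
Markov's inequality, the law of `Θ_0(·, x)` gives mass at most `R ^ (1 - ρ)` to the `R`-ball about
`Θ_0(ξ, x)`, except on a set of points `(ξ, x)` of measure `O(R ^ ρ)`.

*Transport to all `z`.* On an `N`-cylinder `Θ_z` is, up to a constant, `γ ^ N` times
`Θ_{z / b ^ N} ∘ B ^ N` (`exists_cylinder`), and `Θ_{z / b ^ N}` differs from `Θ_0` by
`O(b ^ (-N))`. At scale `r = (γ / b) ^ N` the parameter `z` is therefore invisible inside a cylinder,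
where the estimate for `Θ_0` with `R` of order `b ^ (-N)` applies, and the number of cylinders that
matter is bounded by the estimate for `Θ_z` at the larger scale `γ ^ N` (`volume_cylinder_le`). As
`1 / b ≤ γ`, a loss `r ^ (-κ)` at the larger scale becomes a loss `r ^ (-κ / 2 - ρ)`
(`HasSmallBalls.step`). Starting from the trivial bound `κ = 1`, finitely many steps make the loss
as small as desired, with an exceptional set of measure `O(r ^ δ)` (`hasSmallBalls`). The
theorem follows by covering an interval of length `2 r / |z|` with `O(1 / |z|)` intervals of
length `r`, and by Fubini's theorem.
-/

namespace Weierstrass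

/-! ### The function `s` and Taylor estimates -/

/-- The contraction ratio `γ = 1 / (b λ)` of the stable direction. -/
noncomputable def ratio (b : ℕ) (lam : ℝ) : ℝ := 1 / ((b : ℝ) * lam)

theorem ratio_pos {b : ℕ} {lam : ℝ} (h : 1 < (b : ℝ) * lam) : 0 < ratio b lam := by
  unfold ratio; positivity

theorem ratio_lt_one {b : ℕ} {lam : ℝ} (h : 1 < (b : ℝ) * lam) : ratio b lam < 1 := by
  unfold ratio; rw [div_lt_one (by linarith)]; exact h

/-- The terms of `Θ_z` are difference quotients of the cosine. -/
theorem sFun_mul_sin (t x : ℝ) (ht : t ≠ 0) :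
    sFun t * Real.sin (2 * Real.pi * (x + t / 2)) =
      (Real.cos (2 * Real.pi * x) - Real.cos (2 * Real.pi * x + 2 * Real.pi * t)) / t := by
  rw [Real.cos_sub_cos, sFun, if_neg ht]
  rw [show (2 * Real.pi * x + (2 * Real.pi * x + 2 * Real.pi * t)) / 2
      = 2 * Real.pi * (x + t / 2) by ring,
    show (2 * Real.pi * x - (2 * Real.pi * x + 2 * Real.pi * t)) / 2
      = -(2 * Real.pi * (t / 2)) by ring, Real.sin_neg]
  field_simp

theorem abs_sFun_le (t : ℝ) : |sFun t| ≤ 2 * Real.pi := by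
  unfold sFun
  split_ifs with h
  · rw [abs_of_pos (by positivity)]
  · rw [abs_mul, abs_inv]
    have h0 : 0 < |t / 2| := abs_pos.mpr (by simpa using h)
    rw [inv_mul_le_iff₀ h0]
    calc |Real.sin (2 * Real.pi * (t / 2))| ≤ |2 * Real.pi * (t / 2)| := Real.abs_sin_le_abs
      _ = |t / 2| * (2 * Real.pi) := by
        rw [abs_mul, abs_of_pos (by positivity : 0 < 2 * Real.pi), mul_comm]

/-- First order Taylor estimate for `cos`. -/
theorem abs_cos_add_sub_le (a h : ℝ) :
    |Real.cos (a + h) - Real.cos a + h * Real.sin a| ≤ 3 * h ^ 2 := by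
  have h1 : |Real.cos h - 1| ≤ h ^ 2 := by
    have := Real.one_sub_sq_div_two_le_cos (x := h)
    rw [abs_le]; constructor <;> nlinarith [Real.cos_le_one h, sq_nonneg h]
  have h2 : |h - Real.sin h| ≤ 2 * h ^ 2 := by
    rw [← sq_abs h]
    rcases le_total |h| 1 with hh | hh
    · have := Real.abs_sub_sin_le h
      have h3 : |h| ^ 3 ≤ |h| ^ 2 := pow_le_pow_of_le_one (abs_nonneg _) hh (by norm_num)
      have : 0 ≤ |h| ^ 3 := by positivity
      linarith
    · have h3 : |h - Real.sin h| ≤ |h| + |Real.sin h| := abs_sub _ _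
      have := Real.abs_sin_le_one h
      nlinarith
  rw [show Real.cos (a + h) - Real.cos a + h * Real.sin a
    = Real.cos a * (Real.cos h - 1) + Real.sin a * (h - Real.sin h) by rw [Real.cos_add]; ring]
  calc _ ≤ |Real.cos a * (Real.cos h - 1)| + |Real.sin a * (h - Real.sin h)| := abs_add_le _ _
    _ ≤ 1 * h ^ 2 + 1 * (2 * h ^ 2) := by
      rw [abs_mul, abs_mul]
      gcongr
      · exact Real.abs_cos_le_one a
      · exact Real.abs_sin_le_one a
    _ = 3 * h ^ 2 := by ring

/-- First order Taylor estimate for `sin`. -/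
theorem abs_sin_add_sub_le (a h : ℝ) :
    |Real.sin (a + h) - Real.sin a - h * Real.cos a| ≤ 3 * h ^ 2 := by
  have := abs_cos_add_sub_le (a - Real.pi / 2) h
  rwa [show a - Real.pi / 2 + h = a + h - Real.pi / 2 by ring, Real.cos_sub_pi_div_two,
    Real.cos_sub_pi_div_two, Real.sin_sub_pi_div_two, mul_neg, ← sub_eq_add_neg] at this

theorem abs_sFun_mul_sin_sub_le (t x : ℝ) :
    |sFun t * Real.sin (2 * Real.pi * (x + t / 2)) - 2 * Real.pi * Real.sin (2 * Real.pi * x)|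
      ≤ 12 * Real.pi ^ 2 * |t| := by
  by_cases ht : t = 0
  · subst ht; simp [sFun]
  · rw [sFun_mul_sin t x ht]
    have h := abs_cos_add_sub_le (2 * Real.pi * x) (2 * Real.pi * t)
    have h0 : 0 < |t| := abs_pos.mpr ht
    rw [show (Real.cos (2 * Real.pi * x) - Real.cos (2 * Real.pi * x + 2 * Real.pi * t)) / t
        - 2 * Real.pi * Real.sin (2 * Real.pi * x)
      = -(Real.cos (2 * Real.pi * x + 2 * Real.pi * t) - Real.cos (2 * Real.pi * x)
        + 2 * Real.pi * t * Real.sin (2 * Real.pi * x)) / t by field_simp; ring,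
      abs_div, abs_neg, div_le_iff₀ h0]
    calc _ ≤ _ := h
      _ = 12 * Real.pi ^ 2 * |t| * |t| := by
        rw [mul_assoc _ |t| |t|, abs_mul_abs_self]; ring

/-! ### The baker map and its cylinders -/

theorem orbitX_succ (b n : ℕ) (p : ℝ × ℝ) : orbitX b (n + 1) p = orbitX b n (baker b p) := rfl

theorem orbitX_affine (b n : ℕ) (ξ x : ℝ) :
    orbitX b n (ξ, x) = x / (b : ℝ) ^ n + orbitX b n (ξ, 0) := by
  induction n generalizing ξ x with
  | zero => simp [orbitX]
  | succ n ih =>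
    simp only [orbitX_succ, baker]
    rw [ih, ih (Int.fract _) ((0 + _) / _), pow_succ']
    rw [← div_div]; ring

theorem measurable_baker (b : ℕ) : Measurable (baker b) := by
  unfold baker
  refine Measurable.prodMk ?_ ?_
  · exact measurable_fract.comp (by fun_prop)
  · refine Measurable.div_const (measurable_snd.add ?_) _
    exact (measurable_from_top (f := fun n : ℤ => (n : ℝ))).comp
      (Int.measurable_floor.comp (by fun_prop))

theorem measurable_orbitX (b n : ℕ) : Measurable (orbitX b n) :=
  measurable_snd.comp ((measurable_baker b).iterate n)

theorem Theta_eq_tsum (b : ℕ) (lam z : ℝ) (p : ℝ × ℝ) :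
    Theta b lam z p = ∑' n : ℕ, ratio b lam ^ (n + 1) * (sFun (z / (b : ℝ) ^ (n + 1)) *
      Real.sin (2 * Real.pi * (orbitX b (n + 1) p + z / (b : ℝ) ^ (n + 1) / 2))) := by
  unfold Theta ratio
  congr 1; ext n
  rw [mul_assoc, div_div, mul_comm ((b : ℝ) ^ (n + 1)) 2]

theorem norm_term_le {b : ℕ} {lam : ℝ} (h : 1 < (b : ℝ) * lam) (z : ℝ) (p : ℝ × ℝ) (n : ℕ) :
    ‖ratio b lam ^ (n + 1) * (sFun (z / (b : ℝ) ^ (n + 1)) *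
      Real.sin (2 * Real.pi * (orbitX b (n + 1) p + z / (b : ℝ) ^ (n + 1) / 2)))‖
      ≤ ratio b lam ^ (n + 1) * (2 * Real.pi) := by
  have := ratio_pos h
  rw [norm_mul, norm_mul, Real.norm_eq_abs, Real.norm_eq_abs, Real.norm_eq_abs,
    abs_of_pos (by positivity : 0 < ratio b lam ^ (n + 1))]
  refine mul_le_mul_of_nonneg_left ?_ (by positivity)
  exact (mul_le_mul (abs_sFun_le _) (Real.abs_sin_le_one _) (abs_nonneg _)
    (by positivity)).trans_eq (mul_one _)

theorem summable_pow_succ {g : ℝ} (h0 : 0 ≤ g) (h1 : g < 1) :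
    Summable fun n : ℕ => g ^ (n + 1) :=
  (summable_nat_add_iff 1).mpr (summable_geometric_of_lt_one h0 h1)

theorem tsum_pow_succ {g : ℝ} (h0 : 0 ≤ g) (h1 : g < 1) :
    ∑' n : ℕ, g ^ (n + 1) = g / (1 - g) := by
  simp_rw [pow_succ']
  rw [tsum_mul_left, tsum_geometric_of_lt_one h0 h1, div_eq_mul_inv]

theorem summable_term {b : ℕ} {lam : ℝ} (h : 1 < (b : ℝ) * lam) (z : ℝ) (p : ℝ × ℝ) :
    Summable fun n : ℕ => ratio b lam ^ (n + 1) * (sFun (z / (b : ℝ) ^ (n + 1)) *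
      Real.sin (2 * Real.pi * (orbitX b (n + 1) p + z / (b : ℝ) ^ (n + 1) / 2))) :=
  Summable.of_norm_bounded
    ((summable_pow_succ (ratio_pos h).le (ratio_lt_one h)).mul_right (2 * Real.pi))
    (norm_term_le h z p)

theorem measurable_Theta {b : ℕ} {lam : ℝ} (h : 1 < (b : ℝ) * lam) (z : ℝ) :
    Measurable (Theta b lam z) := by
  refine measurable_of_tendsto_metrizable (f := fun N p => ∑ n ∈ Finset.range N,
    ratio b lam ^ (n + 1) * (sFun (z / (b : ℝ) ^ (n + 1)) *
      Real.sin (2 * Real.pi * (orbitX b (n + 1) p + z / (b : ℝ) ^ (n + 1) / 2)))) ?_ ?_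
  · intro N
    refine Finset.measurable_sum _ fun n _ => ?_
    have := measurable_orbitX b (n + 1)
    fun_prop
  · rw [tendsto_pi_nhds]
    intro p
    rw [Theta_eq_tsum]
    exact (summable_term h z p).hasSum.tendsto_sum_nat

theorem abs_Theta_le {b : ℕ} {lam : ℝ} (h : 1 < (b : ℝ) * lam) (z : ℝ) (p : ℝ × ℝ) :
    |Theta b lam z p| ≤ ratio b lam / (1 - ratio b lam) * (2 * Real.pi) := by
  have h0 := ratio_pos h
  have h1 := ratio_lt_one h
  have hs := summable_pow_succ h0.le h1
  rw [Theta_eq_tsum, ← Real.norm_eq_abs]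
  refine (tsum_of_norm_bounded (hs.mul_right (2 * Real.pi)).hasSum
    (norm_term_le h z p)).trans_eq ?_
  rw [tsum_mul_right, tsum_pow_succ h0.le h1]

/-- `Θ_z` depends on `z` in a Lipschitz way, uniformly on the whole plane. -/
theorem abs_Theta_sub_le {b : ℕ} (hb : 2 ≤ b) {lam : ℝ} (h : 1 < (b : ℝ) * lam) (z : ℝ)
    (p : ℝ × ℝ) :
    |Theta b lam z p - Theta b lam 0 p| ≤ 12 * Real.pi ^ 2 / (1 - ratio b lam) * |z| := by
  have h0 := ratio_pos h
  have h1 := ratio_lt_one h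
  have hs := summable_pow_succ h0.le h1
  have hb1 : (1 : ℝ) ≤ b := by exact_mod_cast (by omega : 1 ≤ b)
  rw [Theta_eq_tsum, Theta_eq_tsum, ← (summable_term h z p).tsum_sub (summable_term h 0 p),
    ← Real.norm_eq_abs]
  refine (tsum_of_norm_bounded (hs.mul_right (12 * Real.pi ^ 2 * |z|)).hasSum fun n => ?_).trans ?_
  · rw [← mul_sub, norm_mul, Real.norm_eq_abs, Real.norm_eq_abs,
      abs_of_pos (by positivity : 0 < ratio b lam ^ (n + 1))]
    gcongr
    have := abs_sFun_mul_sin_sub_le (z / (b : ℝ) ^ (n + 1)) (orbitX b (n + 1) p)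
    simp only [zero_div, add_zero, show sFun 0 = 2 * Real.pi by simp [sFun]]
    refine this.trans (mul_le_mul_of_nonneg_left ?_ (by positivity))
    rw [abs_div]
    refine div_le_self (abs_nonneg _) ?_
    rw [abs_of_pos (by positivity)]
    exact one_le_pow₀ hb1
  · rw [tsum_mul_right, tsum_pow_succ h0.le h1, div_mul_eq_mul_div, div_mul_eq_mul_div]
    have : 0 < 1 - ratio b lam := by linarith
    refine div_le_div_of_nonneg_right ?_ this.le
    have : 0 ≤ 12 * Real.pi ^ 2 * |z| := by positivity
    nlinarith

/-- The self-affinity of `Θ`. -/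
theorem Theta_baker {b : ℕ} {lam : ℝ} (h : 1 < (b : ℝ) * lam) (z : ℝ) (p : ℝ × ℝ) :
    Theta b lam z p = ratio b lam * (sFun (z / b) *
      Real.sin (2 * Real.pi * ((baker b p).2 + z / b / 2)))
        + ratio b lam * Theta b lam (z / b) (baker b p) := by
  rw [Theta_eq_tsum, (summable_term h z p).tsum_eq_zero_add, Theta_eq_tsum, ← tsum_mul_left]
  congr 1
  · simp [orbitX]
  · congr 1; ext n
    rw [orbitX_succ b (n + 1) p, div_div z (b : ℝ), ← pow_succ' (b : ℝ) (n + 1),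
      pow_succ' (ratio b lam) (n + 1), mul_assoc]

theorem baker_cylinder {b : ℕ} (hb : 2 ≤ b) (N j : ℕ) (ξ x : ℝ) (hξ : ξ ∈ Ico (0 : ℝ) 1) :
    baker b (((j : ℝ) + ξ) / (b : ℝ) ^ (N + 1), x)
      = ((((j % b ^ N : ℕ) : ℝ) + ξ) / (b : ℝ) ^ N, (x + ((j / b ^ N : ℕ) : ℝ)) / b) := by
  have hb0 : (0 : ℝ) < b := by exact_mod_cast (by omega : 0 < b)
  have hm : 0 < b ^ N := by positivity
  have hm' : (0 : ℝ) < (b : ℝ) ^ N := by positivity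
  have hj : (j : ℝ) = (b : ℝ) ^ N * ((j / b ^ N : ℕ) : ℝ) + ((j % b ^ N : ℕ) : ℝ) := by
    exact_mod_cast (Nat.div_add_mod j (b ^ N)).symm
  have hlt : ((j % b ^ N : ℕ) : ℝ) + 1 ≤ (b : ℝ) ^ N := by
    exact_mod_cast Nat.mod_lt j hm
  have e : (b : ℝ) * (((j : ℝ) + ξ) / (b : ℝ) ^ (N + 1))
      = ((((j % b ^ N : ℕ) : ℝ) + ξ) / (b : ℝ) ^ N) + ((j / b ^ N : ℕ) : ℝ) := by
    rw [hj, pow_succ']; field_simp; ring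
  have hfr : (((j % b ^ N : ℕ) : ℝ) + ξ) / (b : ℝ) ^ N ∈ Ico (0 : ℝ) 1 := by
    refine ⟨div_nonneg (add_nonneg (Nat.cast_nonneg _) hξ.1) hm'.le, ?_⟩
    rw [div_lt_one hm']; linarith [hξ.2]
  simp only [baker, e, Int.fract_add_natCast, Int.floor_add_natCast,
    Int.fract_eq_self.mpr hfr, Int.floor_eq_zero_iff.mpr hfr, zero_add, Int.cast_natCast]

/-- On the `j`-th cylinder of order `N` the iterate `B^N` maps the base onto `[0,1)`, its second
coordinate is a constant `y`, and `Θ_z` is an affine function, of slope `γ^N`, of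
`Θ_{z / b^N} ∘ B^N`. -/
theorem exists_cylinder {b : ℕ} (hb : 2 ≤ b) {lam : ℝ} (h : 1 < (b : ℝ) * lam) (N j : ℕ)
    (hj : j < b ^ N) (z x : ℝ) (hx : x ∈ Ico (0 : ℝ) 1) :
    ∃ c y : ℝ, y ∈ Ico (0 : ℝ) 1 ∧ ∀ ξ ∈ Ico (0 : ℝ) 1,
      (baker b)^[N] (((j : ℝ) + ξ) / (b : ℝ) ^ N, x) = (ξ, y) ∧
      Theta b lam z (((j : ℝ) + ξ) / (b : ℝ) ^ N, x)
        = c + ratio b lam ^ N * Theta b lam (z / (b : ℝ) ^ N) (ξ, y) := by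
  have hb0 : (0 : ℝ) < b := by exact_mod_cast (by omega : 0 < b)
  induction N generalizing j z x with
  | zero =>
    have : j = 0 := by simpa using hj
    subst this
    exact ⟨0, x, hx, fun ξ hξ => by simp⟩
  | succ N ih =>
    have hm : 0 < b ^ N := by positivity
    have hd : j / b ^ N < b := by
      rw [Nat.div_lt_iff_lt_mul hm, ← pow_succ']; exact hj
    have hd' : ((j / b ^ N : ℕ) : ℝ) + 1 ≤ b := by exact_mod_cast hd
    have hy : (x + ((j / b ^ N : ℕ) : ℝ)) / b ∈ Ico (0 : ℝ) 1 := by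
      refine ⟨div_nonneg (add_nonneg hx.1 (Nat.cast_nonneg _)) hb0.le, ?_⟩
      rw [div_lt_one hb0]; linarith [hx.2]
    obtain ⟨c, y, hy1, H⟩ := ih (j % b ^ N) (Nat.mod_lt j hm) (z / b) _ hy
    refine ⟨ratio b lam * (sFun (z / b) *
      Real.sin (2 * Real.pi * ((x + ((j / b ^ N : ℕ) : ℝ)) / b + z / b / 2))) + ratio b lam * c,
      y, hy1, fun ξ hξ => ?_⟩
    obtain ⟨H1, H2⟩ := H ξ hξ
    constructor
    · rw [Function.iterate_succ_apply, baker_cylinder hb N j ξ x hξ, H1]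
    · rw [Theta_baker h, baker_cylinder hb N j ξ x hξ, H2, div_div z (b : ℝ) ((b : ℝ) ^ N), ← pow_succ',
        pow_succ' (ratio b lam)]
      ring

/-- Splitting `[0,1)` into `m` intervals of equal length. -/
theorem lintegral_Ico_eq_sum (m : ℕ) (hm : 0 < m) (f : ℝ → ENNReal) :
    ∫⁻ ξ in Ico (0 : ℝ) 1, f ξ
      = ∑ j ∈ Finset.range m, (m : ENNReal)⁻¹ * ∫⁻ ξ in Ico (0 : ℝ) 1, f (((j : ℝ) + ξ) / m) := by
  have hm0 : (0 : ℝ) < m := by exact_mod_cast hm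
  have hU : Ico (0 : ℝ) 1 = ⋃ j ∈ Finset.range m, Ico ((j : ℝ) / m) ((j + 1 : ℝ) / m) := by
    ext t
    simp only [mem_iUnion, Finset.mem_range, mem_Ico, exists_prop]
    constructor
    · rintro ⟨h0, h1⟩
      refine ⟨⌊(m : ℝ) * t⌋₊, ?_, ?_, ?_⟩
      · rw [Nat.floor_lt (by positivity)]; nlinarith
      · rw [div_le_iff₀ hm0, mul_comm t]; exact Nat.floor_le (by positivity)
      · rw [lt_div_iff₀ hm0, mul_comm t]; exact Nat.lt_floor_add_one _
    · rintro ⟨j, hj, h0, h1⟩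
      have hj' : (j : ℝ) + 1 ≤ m := by exact_mod_cast hj
      refine ⟨le_trans (by positivity) h0, h1.trans_le ?_⟩
      rw [div_le_one hm0]; exact hj'
  have key : ∀ j : ℕ, ∫⁻ ξ in Ico ((j : ℝ) / m) ((j + 1 : ℝ) / m), f ξ
      = (m : ENNReal)⁻¹ * ∫⁻ ξ in Ico (0 : ℝ) 1, f (((j : ℝ) + ξ) / m) := by
    intro j
    have himg : (fun ξ : ℝ => ((j : ℝ) + ξ) / m) '' Ico (0 : ℝ) 1
        = Ico ((j : ℝ) / m) ((j + 1 : ℝ) / m) := by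
      ext t
      constructor
      · rintro ⟨ξ, ⟨h0, h1⟩, rfl⟩
        constructor
        · exact div_le_div_of_nonneg_right (by linarith) hm0.le
        · exact div_lt_div_of_pos_right (by linarith) hm0
      · rintro ⟨h0, h1⟩
        rw [div_le_iff₀ hm0] at h0
        rw [lt_div_iff₀ hm0] at h1
        refine ⟨t * m - j, ⟨by linarith, by linarith⟩, ?_⟩
        field_simp; ring
    rw [← himg, lintegral_image_eq_lintegral_abs_deriv_mul measurableSet_Ico
      (f' := fun _ => (m : ℝ)⁻¹)]
    · rw [lintegral_const_mul' _ _ (by simp)]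
      congr 1
      rw [abs_of_pos (by positivity), ENNReal.ofReal_inv_of_pos hm0, ENNReal.ofReal_natCast]
    · intro ξ _
      have : HasDerivAt (fun ξ : ℝ => ((j : ℝ) + ξ) / m) (1 / m) ξ :=
        ((hasDerivAt_id ξ).const_add (j : ℝ)).div_const _
      rw [one_div] at this
      exact this.hasDerivWithinAt
    · intro u _ v _ huv
      have : ((j : ℝ) + u) / m = ((j : ℝ) + v) / m := huv
      field_simp at this
      linarith
  rw [hU, lintegral_biUnion_finset]
  · exact Finset.sum_congr rfl fun j _ => (hU ▸ key j)
  · intro i _ j _ hij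
    rw [Function.onFun, Set.disjoint_left]
    rintro t ⟨h0, h1⟩ ⟨h2, h3⟩
    rw [div_le_iff₀ hm0] at h0 h2
    rw [lt_div_iff₀ hm0] at h1 h3
    apply hij
    have a1 : (i : ℝ) < j + 1 := by linarith
    have a2 : (j : ℝ) < i + 1 := by linarith
    have a1' : i < j + 1 := by exact_mod_cast a1
    have a2' : j < i + 1 := by exact_mod_cast a2
    omega
  · intro j _; exact measurableSet_Ico

/-! ### Transversality -/

/-- Up to the factor `4π²`, the derivative of `x ↦ Θ_0(ξ, x)`. -/
noncomputable def slope (b : ℕ) (lam : ℝ) (p : ℝ × ℝ) : ℝ :=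
  ∑' n : ℕ, (ratio b lam / b) ^ (n + 1) * Real.cos (2 * Real.pi * orbitX b (n + 1) p)

theorem ratio_div_pos {b : ℕ} (hb : 2 ≤ b) {lam : ℝ} (h : 1 < (b : ℝ) * lam) :
    0 < ratio b lam / b :=
  div_pos (ratio_pos h) (by exact_mod_cast (by omega : 0 < b))

theorem ratio_div_lt_ratio {b : ℕ} (hb : 2 ≤ b) {lam : ℝ} (h : 1 < (b : ℝ) * lam) :
    ratio b lam / b < ratio b lam :=
  div_lt_self (ratio_pos h) (by exact_mod_cast (by omega : 1 < b))

theorem ratio_div_lt_one {b : ℕ} (hb : 2 ≤ b) {lam : ℝ} (h : 1 < (b : ℝ) * lam) :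
    ratio b lam / b < 1 :=
  (ratio_div_lt_ratio hb h).trans (ratio_lt_one h)

theorem norm_slope_term_le {q : ℝ} (hq : 0 < q) (n : ℕ) (t : ℝ) :
    ‖q ^ (n + 1) * Real.cos t‖ ≤ q ^ (n + 1) := by
  rw [norm_mul, Real.norm_eq_abs, Real.norm_eq_abs, abs_of_pos (by positivity)]
  exact mul_le_of_le_one_right (by positivity) (Real.abs_cos_le_one _)

theorem summable_slope {b : ℕ} (hb : 2 ≤ b) {lam : ℝ} (h : 1 < (b : ℝ) * lam) (p : ℝ × ℝ) :
    Summable fun n : ℕ =>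
      (ratio b lam / b) ^ (n + 1) * Real.cos (2 * Real.pi * orbitX b (n + 1) p) :=
  Summable.of_norm_bounded
    (summable_pow_succ (ratio_div_pos hb h).le (ratio_div_lt_one hb h))
    (fun n => norm_slope_term_le (ratio_div_pos hb h) n _)

theorem abs_slope_le {b : ℕ} (hb : 2 ≤ b) {lam : ℝ} (h : 1 < (b : ℝ) * lam) (p : ℝ × ℝ) :
    |slope b lam p| ≤ ratio b lam / b / (1 - ratio b lam / b) := by
  have h0 := ratio_div_pos hb h
  have h1 := ratio_div_lt_one hb h
  rw [slope, ← Real.norm_eq_abs, ← tsum_pow_succ h0.le h1]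
  exact tsum_of_norm_bounded (summable_pow_succ h0.le h1).hasSum
    (fun n => norm_slope_term_le h0 n _)

theorem slope_baker {b : ℕ} (hb : 2 ≤ b) {lam : ℝ} (h : 1 < (b : ℝ) * lam) (p : ℝ × ℝ) :
    slope b lam p = ratio b lam / b * Real.cos (2 * Real.pi * (baker b p).2)
      + ratio b lam / b * slope b lam (baker b p) := by
  rw [slope, (summable_slope hb h p).tsum_eq_zero_add, slope, ← tsum_mul_left]
  congr 1
  · simp [orbitX]
  · congr 1; ext n
    rw [orbitX_succ b (n + 1) p, pow_succ' _ (n + 1), mul_assoc]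

theorem Theta_zero_eq (b : ℕ) (lam : ℝ) (p : ℝ × ℝ) :
    Theta b lam 0 p = ∑' n : ℕ, ratio b lam ^ (n + 1) *
      (2 * Real.pi * Real.sin (2 * Real.pi * orbitX b (n + 1) p)) := by
  rw [Theta_eq_tsum]
  simp [sFun]

theorem summable_Theta_zero {b : ℕ} {lam : ℝ} (h : 1 < (b : ℝ) * lam) (p : ℝ × ℝ) :
    Summable fun n : ℕ => ratio b lam ^ (n + 1) *
      (2 * Real.pi * Real.sin (2 * Real.pi * orbitX b (n + 1) p)) := by
  have := summable_term h 0 p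
  simpa [sFun] using this

theorem Theta_zero_baker {b : ℕ} {lam : ℝ} (h : 1 < (b : ℝ) * lam) (p : ℝ × ℝ) :
    Theta b lam 0 p = ratio b lam * (2 * Real.pi * Real.sin (2 * Real.pi * (baker b p).2))
        + ratio b lam * Theta b lam 0 (baker b p) := by
  rw [Theta_baker h]
  simp [sFun]

/-- `4π²` times `slope` is the derivative of `Θ_0` along `x`, with a uniform quadratic error. -/
theorem abs_Theta_zero_add_sub_le {b : ℕ} (hb : 2 ≤ b) {lam : ℝ} (h : 1 < (b : ℝ) * lam)
    (ξ x t : ℝ) :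
    |Theta b lam 0 (ξ, x + t) - Theta b lam 0 (ξ, x)
      - t * (4 * Real.pi ^ 2 * slope b lam (ξ, x))|
      ≤ ratio b lam / (1 - ratio b lam) * (24 * Real.pi ^ 3 * t ^ 2) := by
  have h0 := ratio_pos h
  have h1 := ratio_lt_one h
  have hs := summable_pow_succ h0.le h1
  have hb1 : (1 : ℝ) ≤ b := by exact_mod_cast (by omega : 1 ≤ b)
  have hb0 : (0 : ℝ) < b := by linarith
  rw [Theta_zero_eq, Theta_zero_eq, slope, ← tsum_mul_left, ← tsum_mul_left,
    ← (summable_Theta_zero h _).tsum_sub (summable_Theta_zero h _),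
    ← ((summable_Theta_zero h _).sub (summable_Theta_zero h _)).tsum_sub
      (((summable_slope hb h _).mul_left _).mul_left _), ← Real.norm_eq_abs,
    ← tsum_pow_succ h0.le h1, ← tsum_mul_right]
  refine tsum_of_norm_bounded (hs.mul_right _).hasSum fun n => ?_
  have hbn : (1 : ℝ) ≤ (b : ℝ) ^ (n + 1) := one_le_pow₀ hb1
  have hbn0 : (0 : ℝ) < (b : ℝ) ^ (n + 1) := by positivity
  have ho : orbitX b (n + 1) (ξ, x + t) = orbitX b (n + 1) (ξ, x) + t / (b : ℝ) ^ (n + 1) := by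
    rw [orbitX_affine, orbitX_affine b (n + 1) ξ x]; ring
  rw [ho]
  set X := orbitX b (n + 1) (ξ, x)
  have ht := abs_sin_add_sub_le (2 * Real.pi * X) (2 * Real.pi * (t / (b : ℝ) ^ (n + 1)))
  rw [show ratio b lam ^ (n + 1) * (2 * Real.pi *
        Real.sin (2 * Real.pi * (X + t / (b : ℝ) ^ (n + 1)))) -
      ratio b lam ^ (n + 1) * (2 * Real.pi * Real.sin (2 * Real.pi * X)) -
      t * (4 * Real.pi ^ 2 * ((ratio b lam / b) ^ (n + 1) * Real.cos (2 * Real.pi * X)))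
    = ratio b lam ^ (n + 1) * (2 * Real.pi * (
      Real.sin (2 * Real.pi * X + 2 * Real.pi * (t / (b : ℝ) ^ (n + 1)))
        - Real.sin (2 * Real.pi * X)
        - 2 * Real.pi * (t / (b : ℝ) ^ (n + 1)) * Real.cos (2 * Real.pi * X))) by
    rw [div_pow, mul_add (2 * Real.pi)]; ring]
  rw [norm_mul, norm_mul, Real.norm_eq_abs, Real.norm_eq_abs, Real.norm_eq_abs,
    abs_of_pos (by positivity : 0 < ratio b lam ^ (n + 1)),
    abs_of_pos (by positivity : 0 < 2 * Real.pi)]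
  refine mul_le_mul_of_nonneg_left ?_ (by positivity)
  calc _ ≤ 2 * Real.pi * (3 * (2 * Real.pi * (t / (b : ℝ) ^ (n + 1))) ^ 2) := by gcongr
    _ = 24 * Real.pi ^ 3 * (t / (b : ℝ) ^ (n + 1)) ^ 2 := by ring
    _ ≤ 24 * Real.pi ^ 3 * t ^ 2 := by
      refine mul_le_mul_of_nonneg_left ?_ (by positivity)
      rw [div_pow]
      exact div_le_self (sq_nonneg _) (one_le_pow₀ hbn)

/-- A vector of length at least `2√κ` cannot be moved close to the origin by a vector whose
coordinates are bounded by `2u` and `2v`, if `u² + v² < κ`. -/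
theorem exists_eps_of_sq_add_sq_lt {u v κ : ℝ} (hu : 0 ≤ u) (hv : 0 ≤ v)
    (h : u ^ 2 + v ^ 2 < κ) :
    ∃ ε : ℝ, 0 < ε ∧ ∀ A A' m m' : ℝ, |A - m| ≤ 2 * u → |A' - m'| ≤ 2 * v →
      4 * κ ≤ m ^ 2 + m' ^ 2 → |A| < ε → ε ≤ |A'| := by
  set d := (κ - u ^ 2 - v ^ 2) / (u + v + 1) with hd
  have hd0 : 0 < d := div_pos (by linarith) (by linarith)
  refine ⟨min 1 d, lt_min one_pos hd0, fun A A' m m' h1 h2 h3 h4 => ?_⟩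
  by_contra! h5
  set ε := min 1 d with hε
  have hε0 : 0 < ε := lt_min one_pos hd0
  have e1 : ε ≤ 1 := min_le_left _ _
  have e2 : ε * (u + v + 1) ≤ κ - u ^ 2 - v ^ 2 := by
    rw [← le_div_iff₀ (by linarith)]; exact min_le_right _ _
  have m1 : |m| ≤ ε + 2 * u := by
    have := abs_sub A (A - m)
    rw [sub_sub_cancel] at this; linarith
  have m2 : |m'| ≤ ε + 2 * v := by
    have := abs_sub A' (A' - m')
    rw [sub_sub_cancel] at this; linarith
  have s1 : m ^ 2 ≤ (ε + 2 * u) ^ 2 := by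
    rw [← sq_abs m]; exact pow_le_pow_left₀ (abs_nonneg _) m1 2
  have s2 : m' ^ 2 ≤ (ε + 2 * v) ^ 2 := by
    rw [← sq_abs m']; exact pow_le_pow_left₀ (abs_nonneg _) m2 2
  nlinarith

theorem sin_sq_pi_div_le {b : ℕ} (hb : 2 ≤ b) (d : ℕ) (hd : 1 ≤ d) (hdb : d + 1 ≤ b) :
    Real.sin (Real.pi / b) ^ 2 ≤ Real.sin (Real.pi * d / b) ^ 2 := by
  have hb2 : (2 : ℝ) ≤ b := by exact_mod_cast hb
  have hb0 : (0 : ℝ) < b := by linarith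
  have hd' : (1 : ℝ) ≤ d := by exact_mod_cast hd
  have hdb' : (d : ℝ) + 1 ≤ b := by exact_mod_cast hdb
  have hp := Real.pi_pos
  have p0 : 0 < Real.pi / b := by positivity
  have p1 : Real.pi / b ≤ Real.pi / 2 := by gcongr
  have p2 : Real.pi / b ≤ Real.pi * d / b := by
    gcongr; nlinarith
  have p3 : Real.pi / b ≤ Real.pi - Real.pi * d / b := by
    rw [le_sub_iff_add_le, ← add_div, div_le_iff₀ hb0]; nlinarith
  refine pow_le_pow_left₀ (Real.sin_nonneg_of_nonneg_of_le_pi p0.le (by linarith)) ?_ 2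
  rcases le_total (Real.pi * d / b) (Real.pi / 2) with hle | hle
  · exact Real.sin_le_sin_of_le_of_le_pi_div_two (by linarith) hle p2
  · rw [← Real.sin_pi_sub (Real.pi * d / b)]
    exact Real.sin_le_sin_of_le_of_le_pi_div_two (by linarith) (by linarith) p3

theorem four_mul_sin_sq_le {b : ℕ} (hb : 2 ≤ b) (x : ℝ) (k l : ℤ) (hkl : k ≠ l)
    (hk0 : 0 ≤ k) (hk1 : k < b) (hl0 : 0 ≤ l) (hl1 : l < b) :
    4 * Real.sin (Real.pi / b) ^ 2 ≤
      (Real.sin (2 * Real.pi * ((x + k) / b)) - Real.sin (2 * Real.pi * ((x + l) / b))) ^ 2 +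
      (Real.cos (2 * Real.pi * ((x + k) / b)) - Real.cos (2 * Real.pi * ((x + l) / b))) ^ 2 := by
  set α := 2 * Real.pi * ((x + k) / b)
  set β := 2 * Real.pi * ((x + l) / b)
  have e : (Real.sin α - Real.sin β) ^ 2 + (Real.cos α - Real.cos β) ^ 2
      = 4 * Real.sin ((α - β) / 2) ^ 2 := by
    rw [Real.sin_sq_eq_half_sub, mul_div_cancel₀ (α - β) two_ne_zero, Real.cos_sub]
    nlinarith [Real.sin_sq_add_cos_sq α, Real.sin_sq_add_cos_sq β]
  rw [e]
  have hd : Real.sin ((α - β) / 2) ^ 2 = Real.sin (Real.pi * ((k - l).natAbs : ℕ) / b) ^ 2 := by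
    have h1 : (α - β) / 2 = Real.pi * ((k - l : ℤ) : ℝ) / b := by
      simp only [α, β]; push_cast; ring
    rw [h1]
    rcases Int.natAbs_eq (k - l) with h2 | h2
    · rw [← Int.cast_natCast (R := ℝ) (k - l).natAbs, ← h2]
    · have h3 : ((k - l : ℤ) : ℝ) = -(((k - l).natAbs : ℕ) : ℝ) := by
        rw [← Int.cast_natCast (R := ℝ) (k - l).natAbs, ← Int.cast_neg, ← h2]
      rw [h3, mul_neg, neg_div, Real.sin_neg, neg_sq]
  rw [hd]
  have := sin_sq_pi_div_le hb (k - l).natAbs (by omega) (by omega)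
  linarith

/-- The lower bound behind transversality for `b = 2`, in terms of `s = sin φ`, `c = cos φ`. -/
theorem two_term_bound {γ s c σ : ℝ} (hγ0 : 0 < γ) (hγ1 : γ < 1) (hsc : s ^ 2 + c ^ 2 = 1)
    (hσ : σ ^ 2 = 1) :
    4 * (1 - √2 * γ + 5 / 16 * γ ^ 2) ≤
      (2 * (2 * s * c) + γ * (s - σ * c)) ^ 2
        + (2 * (c ^ 2 - s ^ 2) + γ / 2 * (c + σ * s)) ^ 2 := by
  -- everything can be written in terms of `τ = σ (s - σ c)`
  set τ := σ * (s - σ * c) with hτ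
  have hτ2 : τ ^ 2 = 1 - 2 * σ * s * c := by
    have : τ ^ 2 = σ ^ 2 * (s ^ 2 - 2 * σ * s * c + σ ^ 2 * c ^ 2) := by rw [hτ]; ring
    rw [this, hσ]; linarith
  have hτle : τ ^ 2 ≤ 2 := by
    have : (s + σ * c) ^ 2 = s ^ 2 + 2 * σ * s * c + σ ^ 2 * c ^ 2 := by ring
    rw [hσ] at this
    nlinarith [sq_nonneg (s + σ * c)]
  have hr0 : 0 ≤ √2 := Real.sqrt_nonneg 2
  have hr2 : √2 ^ 2 = 2 := Real.sq_sqrt (by norm_num)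
  have hr1 : 1 ≤ √2 := by rw [Real.one_le_sqrt]; norm_num
  have hτr : τ ≤ √2 := Real.le_sqrt_of_sq_le hτle
  have e : (2 * (2 * s * c) + γ * (s - σ * c)) ^ 2
        + (2 * (c ^ 2 - s ^ 2) + γ / 2 * (c + σ * s)) ^ 2
      = 4 * (1 - γ * τ ^ 3 / 2 + γ ^ 2 * (1 / 8 + 3 / 16 * τ ^ 2)) := by
    have a1 : (2 * (2 * s * c)) ^ 2 + (2 * (c ^ 2 - s ^ 2)) ^ 2 = 4 := by
      have : (2 * (2 * s * c)) ^ 2 + (2 * (c ^ 2 - s ^ 2)) ^ 2 = 4 * (s ^ 2 + c ^ 2) ^ 2 := by ring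
      rw [this, hsc]; norm_num
    have a2 : (s - σ * c) ^ 2 = τ ^ 2 := by rw [hτ, mul_pow, hσ, one_mul]
    have a3 : (c + σ * s) ^ 2 = 2 - τ ^ 2 := by
      have : (c + σ * s) ^ 2 = c ^ 2 + 2 * σ * s * c + σ ^ 2 * s ^ 2 := by ring
      rw [this, hσ, hτ2]; linarith
    have a4 : 2 * (2 * s * c) * (s - σ * c) * 2 + 2 * (c ^ 2 - s ^ 2) * (c + σ * s)
        = - 2 * τ ^ 3 := by
      have b1 : τ ^ 3 = τ * τ ^ 2 := by ring
      have b2 : τ = σ * s - c := by rw [hτ]; linear_combination (-c) * hσ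
      rw [b1, hτ2, b2]
      have b3 : c ^ 2 - s ^ 2 = 1 - 2 * s ^ 2 := by linarith
      rw [b3]
      have c2 : c ^ 2 = 1 - s ^ 2 := by linarith
      linear_combination (-4 * s ^ 2 * c) * hσ + (-4 * σ * s) * c2
    linear_combination a1 + γ ^ 2 * a2 + γ ^ 2 / 4 * a3 + γ * a4
  rw [e]
  have f1 : τ ^ 3 ≤ √2 * τ ^ 2 := by nlinarith [sq_nonneg τ]
  have f2 : 3 / 16 * γ * (1 - τ ^ 2) ≤ √2 - τ ^ 3 / 2 := by
    have g1 : 1 - τ ^ 2 / 2 ≤ √2 * (1 - τ ^ 2 / 2) :=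
      le_mul_of_one_le_left (by linarith) hr1
    have g2 : 3 / 16 * γ * (1 - τ ^ 2) ≤ 1 - τ ^ 2 / 2 := by
      rcases le_total (τ ^ 2) 1 with g | g
      · nlinarith [sq_nonneg τ]
      · nlinarith
    linarith
  nlinarith

theorem one_lt_mul_of_lambdaCrit_lt {b : ℕ} (hb : 2 ≤ b) {lam : ℝ}
    (hlam : lambdaCrit b hb < lam) : 1 < (b : ℝ) * lam := by
  have hb0 : (0 : ℝ) < b := by exact_mod_cast (by omega : 0 < b)
  have h := (lambdaCrit_spec b hb).1.1.trans hlam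
  rwa [div_lt_iff₀ hb0, mul_comm] at h

theorem hFun_neg_of_lambdaCrit_lt {b : ℕ} (hb : 2 ≤ b) {lam : ℝ}
    (hlam : lam ∈ Ioo (lambdaCrit b hb) 1) : hFun b lam < 0 := by
  obtain ⟨⟨h1, h2⟩, h3⟩ := lambdaCrit_spec b hb
  rw [← h3]
  exact hFun_strictAntiOn b hb ⟨h1, h2.le⟩ ⟨h1.trans hlam.1, hlam.2.le⟩ hlam.1

theorem floor_mul_mem {b : ℕ} {ξ : ℝ} (hξ : ξ ∈ Ico (0 : ℝ) 1) (hb : 2 ≤ b) :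
    0 ≤ ⌊(b : ℝ) * ξ⌋ ∧ ⌊(b : ℝ) * ξ⌋ < b := by
  have hb0 : (0 : ℝ) < b := by exact_mod_cast (by omega : 0 < b)
  refine ⟨Int.floor_nonneg.mpr (mul_nonneg hb0.le hξ.1), ?_⟩
  rw [Int.floor_lt]; push_cast; nlinarith [hξ.2]

/-- Transversality for `b ≥ 3`: the first digits alone decide. -/
theorem transversality_of_three_le {b : ℕ} (hb : 3 ≤ b) {lam : ℝ}
    (h : 1 < (b : ℝ) * lam) (hneg : hFun b lam < 0) :
    ∃ ε : ℝ, 0 < ε ∧ ∀ ξ ∈ Ico (0 : ℝ) 1, ∀ ξ' ∈ Ico (0 : ℝ) 1,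
      ⌊(b : ℝ) * ξ⌋ ≠ ⌊(b : ℝ) * ξ'⌋ → ∀ x : ℝ,
      |(Theta b lam 0 (ξ, x) - Theta b lam 0 (ξ', x)) / (2 * Real.pi * ratio b lam)| < ε →
      ε ≤ |(slope b lam (ξ, x) - slope b lam (ξ', x)) / (ratio b lam / b)| := by
  have hb2 : 2 ≤ b := by omega
  have hb3 : (3 : ℝ) ≤ b := by exact_mod_cast hb
  have hb0 : (0 : ℝ) < b := by linarith
  have g0 := ratio_pos h
  have g1 := ratio_lt_one h
  have q0 := ratio_div_pos hb2 h
  have q1 := ratio_div_lt_one hb2 h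
  have hl0 : 0 < lam := by
    by_contra! hl
    nlinarith
  have eu : ratio b lam / (1 - ratio b lam) = 1 / ((b : ℝ) * lam - 1) := by
    have : (b : ℝ) * lam - 1 ≠ 0 := by linarith
    have h' : 1 - ratio b lam ≠ 0 := by linarith
    rw [div_eq_div_iff h' this]; unfold ratio; field_simp
  have ev : ratio b lam / b / (1 - ratio b lam / b) = 1 / ((b : ℝ) ^ 2 * lam - 1) := by
    have : (b : ℝ) ^ 2 * lam - 1 ≠ 0 := by nlinarith
    have h' : 1 - ratio b lam / b ≠ 0 := by linarith
    rw [div_eq_div_iff h' this]; unfold ratio; field_simp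
  rw [hFun, if_neg (by omega)] at hneg
  obtain ⟨ε, hε, H⟩ := exists_eps_of_sq_add_sq_lt (u := ratio b lam / (1 - ratio b lam))
    (v := ratio b lam / b / (1 - ratio b lam / b)) (κ := Real.sin (Real.pi / b) ^ 2)
    (div_nonneg g0.le (by linarith)) (div_nonneg q0.le (by linarith))
    (by rw [eu, ev, div_pow, div_pow, one_pow]; linarith)
  refine ⟨ε, hε, fun ξ hξ ξ' hξ' hne x hx => ?_⟩
  obtain ⟨k0, k1⟩ := floor_mul_mem hξ hb2
  obtain ⟨l0, l1⟩ := floor_mul_mem hξ' hb2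
  refine H _ _ _ _ ?_ ?_ (four_mul_sin_sq_le hb2 x _ _ hne k0 k1 l0 l1) hx
  · have t1 := abs_Theta_le h 0 (baker b (ξ, x))
    have t2 := abs_Theta_le h 0 (baker b (ξ', x))
    rw [Theta_zero_baker h (ξ, x), Theta_zero_baker h (ξ', x)]
    simp only [baker] at t1 t2 ⊢
    rw [show ∀ S S' T T' : ℝ, (ratio b lam * (2 * Real.pi * S) + ratio b lam * T
        - (ratio b lam * (2 * Real.pi * S') + ratio b lam * T')) / (2 * Real.pi * ratio b lam)
        - (S - S') = (T - T') / (2 * Real.pi) by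
      intros; field_simp; ring]
    rw [abs_div, abs_of_pos (by positivity : 0 < 2 * Real.pi), div_le_iff₀ (by positivity)]
    refine (abs_sub _ _).trans ?_
    linarith
  · have t1 := abs_slope_le hb2 h (baker b (ξ, x))
    have t2 := abs_slope_le hb2 h (baker b (ξ', x))
    rw [slope_baker hb2 h (ξ, x), slope_baker hb2 h (ξ', x)]
    simp only [baker] at t1 t2 ⊢
    rw [show ∀ S S' T T' : ℝ, (ratio b lam / b * S + ratio b lam / b * T
        - (ratio b lam / b * S' + ratio b lam / b * T')) / (ratio b lam / b)
        - (S - S') = (T - T') by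
      intros; field_simp; ring]
    refine (abs_sub _ _).trans ?_
    linarith

/-- Shifting the angle by an odd multiple of `π / 2` exchanges sine and cosine up to one common
sign `σ`. -/
theorem sin_cos_add_odd_mul_pi_div_two (φ : ℝ) (j : ℤ) :
    ∃ σ : ℝ, σ ^ 2 = 1 ∧ Real.sin (φ + (2 * j + 1) * (Real.pi / 2)) = σ * Real.cos φ ∧
      Real.cos (φ + (2 * j + 1) * (Real.pi / 2)) = - (σ * Real.sin φ) := by
  refine ⟨(-1) ^ j, ?_, ?_, ?_⟩
  · rcases Int.even_or_odd j with hj | hj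
    · rw [hj.neg_one_zpow]; norm_num
    · rw [hj.neg_one_zpow]; norm_num
  · rw [show φ + (2 * j + 1) * (Real.pi / 2) = φ + Real.pi / 2 + j * Real.pi by ring,
      Real.sin_add_int_mul_pi, Real.sin_add_pi_div_two]
  · rw [show φ + (2 * j + 1) * (Real.pi / 2) = φ + Real.pi / 2 + j * Real.pi by ring,
      Real.cos_add_int_mul_pi, Real.cos_add_pi_div_two, mul_neg]

/-- Main part of `D` and `D'` for `b = 2`: the contribution of the first two digits. -/
theorem two_digit_bound {γ : ℝ} (hγ0 : 0 < γ) (hγ1 : γ < 1) (x : ℝ) (k l m n : ℤ)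
    (hkl : k ≠ l) (hk0 : 0 ≤ k) (hk1 : k < 2) (hl0 : 0 ≤ l) (hl1 : l < 2) :
    4 * (1 - √2 * γ + 5 / 16 * γ ^ 2) ≤
      (Real.sin (2 * Real.pi * ((x + k) / 2)) - Real.sin (2 * Real.pi * ((x + l) / 2))
        + γ * (Real.sin (2 * Real.pi * (((x + k) / 2 + m) / 2))
          - Real.sin (2 * Real.pi * (((x + l) / 2 + n) / 2)))) ^ 2 +
      (Real.cos (2 * Real.pi * ((x + k) / 2)) - Real.cos (2 * Real.pi * ((x + l) / 2))
        + γ / 2 * (Real.cos (2 * Real.pi * (((x + k) / 2 + m) / 2))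
          - Real.cos (2 * Real.pi * (((x + l) / 2 + n) / 2)))) ^ 2 := by
  set φ := 2 * Real.pi * (((x + k) / 2 + m) / 2) with hφ
  obtain ⟨i, hi⟩ : ∃ i : ℤ, l - k = 2 * i + 1 := by
    rcases (by omega : (k = 0 ∧ l = 1) ∨ (k = 1 ∧ l = 0)) with ⟨rfl, rfl⟩ | ⟨rfl, rfl⟩
    · exact ⟨0, rfl⟩
    · exact ⟨-1, rfl⟩
  have hi' : (l : ℝ) = k + 2 * i + 1 := by
    have : l = k + 2 * i + 1 := by omega
    rw [this]; push_cast; ring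
  obtain ⟨σ, hσ, e1, e2⟩ := sin_cos_add_odd_mul_pi_div_two φ (i + n - m)
  have a1 : 2 * Real.pi * ((x + k) / 2) = 2 * φ - m * (2 * Real.pi) := by rw [hφ]; ring
  have a2 : 2 * Real.pi * ((x + l) / 2) = 2 * φ - m * (2 * Real.pi) + Real.pi
      + i * (2 * Real.pi) := by rw [hφ, hi']; ring
  have a3 : 2 * Real.pi * (((x + l) / 2 + n) / 2)
      = φ + (2 * (i + n - m : ℤ) + 1) * (Real.pi / 2) := by
    rw [hφ, hi']; push_cast; ring
  rw [a3, e1, e2, a2, a1, Real.sin_add_int_mul_two_pi, Real.cos_add_int_mul_two_pi,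
    Real.sin_add_pi, Real.cos_add_pi, Real.sin_sub_int_mul_two_pi, Real.cos_sub_int_mul_two_pi,
    Real.sin_two_mul, Real.cos_two_mul']
  refine (two_term_bound hγ0 hγ1 (Real.sin_sq_add_cos_sq φ) hσ).trans_eq ?_
  ring

/-- Transversality for `b = 2`, by means of the first two digits. -/
theorem transversality_two {lam : ℝ} (h : 1 < ((2 : ℕ) : ℝ) * lam) (hneg : hFun 2 lam < 0) :
    ∃ ε : ℝ, 0 < ε ∧ ∀ ξ ∈ Ico (0 : ℝ) 1, ∀ ξ' ∈ Ico (0 : ℝ) 1,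
      ⌊((2 : ℕ) : ℝ) * ξ⌋ ≠ ⌊((2 : ℕ) : ℝ) * ξ'⌋ → ∀ x : ℝ,
      |(Theta 2 lam 0 (ξ, x) - Theta 2 lam 0 (ξ', x)) / (2 * Real.pi * ratio 2 lam)| < ε →
      ε ≤ |(slope 2 lam (ξ, x) - slope 2 lam (ξ', x)) / (ratio 2 lam / (2 : ℕ))| := by
  have g0 := ratio_pos h
  have g1 := ratio_lt_one h
  have q0 := ratio_div_pos le_rfl h
  have q1 := ratio_div_lt_one le_rfl h
  have hl0 : 0 < lam := by
    by_contra! hl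
    have : (2 : ℕ) * lam ≤ 0 := by push_cast; linarith
    linarith
  have h2 : 1 < 2 * lam := by exact_mod_cast h
  have eγ : ratio 2 lam = 1 / (2 * lam) := by unfold ratio; push_cast; rfl
  have eu : ratio 2 lam * (ratio 2 lam / (1 - ratio 2 lam)) = 1 / (2 * lam * (2 * lam - 1)) := by
    have : 2 * lam - 1 ≠ 0 := by linarith
    have h' : 1 - ratio 2 lam ≠ 0 := by linarith
    rw [← mul_div_assoc, div_eq_div_iff h' (by positivity), eγ]; field_simp
  have ev : ratio 2 lam / (2 : ℕ) * (ratio 2 lam / (2 : ℕ) / (1 - ratio 2 lam / (2 : ℕ)))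
      = 1 / (4 * lam * (4 * lam - 1)) := by
    have : 4 * lam - 1 ≠ 0 := by linarith
    have h' : 1 - ratio 2 lam / (2 : ℕ) ≠ 0 := by linarith
    rw [← mul_div_assoc, div_eq_div_iff h' (by positivity), eγ]; push_cast; field_simp; ring
  rw [hFun, if_pos rfl] at hneg
  obtain ⟨ε, hε, H⟩ := exists_eps_of_sq_add_sq_lt
    (u := ratio 2 lam * (ratio 2 lam / (1 - ratio 2 lam)))
    (v := ratio 2 lam / (2 : ℕ) * (ratio 2 lam / (2 : ℕ) / (1 - ratio 2 lam / (2 : ℕ))))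
    (κ := 1 - √2 * ratio 2 lam + 5 / 16 * ratio 2 lam ^ 2)
    (mul_nonneg g0.le (div_nonneg g0.le (by linarith)))
    (mul_nonneg q0.le (div_nonneg q0.le (by linarith)))
    (by
      rw [eu, ev, eγ]
      have i1 : (1 / (2 * lam * (2 * lam - 1))) ^ 2 = 1 / (4 * lam ^ 2 * (2 * lam - 1) ^ 2) := by
        rw [div_pow, mul_pow, mul_pow]; norm_num
      have i2 : (1 / (4 * lam * (4 * lam - 1))) ^ 2 = 1 / (16 * lam ^ 2 * (4 * lam - 1) ^ 2) := by
        rw [div_pow, mul_pow, mul_pow]; norm_num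
      have i3 : √2 * (1 / (2 * lam)) = √2 / (2 * lam) := by ring
      have i4 : 5 / 16 * (1 / (2 * lam)) ^ 2 = 5 / (64 * lam ^ 2) := by
        field_simp; norm_num
      rw [i1, i2, i3, i4]; linarith)
  refine ⟨ε, hε, fun ξ hξ ξ' hξ' hne x hx => ?_⟩
  obtain ⟨k0, k1⟩ := floor_mul_mem hξ le_rfl
  obtain ⟨l0, l1⟩ := floor_mul_mem hξ' le_rfl
  refine H _ _ _ _ ?_ ?_ (two_digit_bound g0 g1 x _ _
    ⌊((2 : ℕ) : ℝ) * Int.fract (((2 : ℕ) : ℝ) * ξ)⌋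
    ⌊((2 : ℕ) : ℝ) * Int.fract (((2 : ℕ) : ℝ) * ξ')⌋ hne k0 k1 l0 l1) hx
  · have t1 := abs_Theta_le h 0 (baker 2 (baker 2 (ξ, x)))
    have t2 := abs_Theta_le h 0 (baker 2 (baker 2 (ξ', x)))
    rw [Theta_zero_baker h (ξ, x), Theta_zero_baker h (ξ', x),
      Theta_zero_baker h (baker 2 (ξ, x)), Theta_zero_baker h (baker 2 (ξ', x))]
    simp only [baker] at t1 t2 ⊢
    rw [show ∀ γ S S' S₂ S₂' T T' : ℝ, (γ * (2 * Real.pi * S)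
        + γ * (γ * (2 * Real.pi * S₂) + γ * T)
        - (γ * (2 * Real.pi * S') + γ * (γ * (2 * Real.pi * S₂') + γ * T')))
          / (2 * Real.pi * γ)
        = (S - S' + γ * (S₂ - S₂') + γ * ((T - T') / (2 * Real.pi))) * (γ / γ) by
      intros; field_simp; ring, div_self g0.ne', mul_one]
    push_cast at t1 t2 ⊢
    rw [add_sub_cancel_left, abs_mul, abs_of_pos g0, mul_left_comm]
    refine mul_le_mul_of_nonneg_left ?_ g0.le
    rw [abs_div, abs_of_pos (by positivity : 0 < 2 * Real.pi), div_le_iff₀ (by positivity)]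
    refine (abs_sub _ _).trans ?_
    linarith
  · have t1 := abs_slope_le le_rfl h (baker 2 (baker 2 (ξ, x)))
    have t2 := abs_slope_le le_rfl h (baker 2 (baker 2 (ξ', x)))
    rw [slope_baker le_rfl h (ξ, x), slope_baker le_rfl h (ξ', x),
      slope_baker le_rfl h (baker 2 (ξ, x)), slope_baker le_rfl h (baker 2 (ξ', x))]
    simp only [baker] at t1 t2 ⊢
    rw [show ∀ γ S S' S₂ S₂' T T' : ℝ, (γ * S + γ * (γ * S₂ + γ * T)
        - (γ * S' + γ * (γ * S₂' + γ * T'))) / γ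
        = (S - S' + γ * (S₂ - S₂') + γ * (T - T')) * (γ / γ) by
      intros; ring, div_self q0.ne', mul_one]
    push_cast at t1 t2 q0 ⊢
    rw [add_sub_cancel_left, abs_mul, abs_of_pos q0, mul_left_comm]
    refine mul_le_mul_of_nonneg_left ?_ q0.le
    refine (abs_sub _ _).trans ?_
    linarith

/-- Two points of the unit interval with different first digits have transversal graphs
`x ↦ Θ_0(ξ, x)` and `x ↦ Θ_0(ξ', x)`: where these functions are close, their derivatives are
far apart. -/
theorem transversality {b : ℕ} (hb : 2 ≤ b) {lam : ℝ}
    (h : 1 < (b : ℝ) * lam) (hneg : hFun b lam < 0) :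
    ∃ ε : ℝ, 0 < ε ∧ ∀ ξ ∈ Ico (0 : ℝ) 1, ∀ ξ' ∈ Ico (0 : ℝ) 1,
      ⌊(b : ℝ) * ξ⌋ ≠ ⌊(b : ℝ) * ξ'⌋ → ∀ x : ℝ,
      |Theta b lam 0 (ξ, x) - Theta b lam 0 (ξ', x)| < ε →
      ε ≤ |4 * Real.pi ^ 2 * slope b lam (ξ, x) - 4 * Real.pi ^ 2 * slope b lam (ξ', x)| := by
  have g0 := ratio_pos h
  have q0 := ratio_div_pos hb h
  obtain ⟨ε, hε, H⟩ : ∃ ε : ℝ, 0 < ε ∧ ∀ ξ ∈ Ico (0 : ℝ) 1, ∀ ξ' ∈ Ico (0 : ℝ) 1,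
      ⌊(b : ℝ) * ξ⌋ ≠ ⌊(b : ℝ) * ξ'⌋ → ∀ x : ℝ,
      |(Theta b lam 0 (ξ, x) - Theta b lam 0 (ξ', x)) / (2 * Real.pi * ratio b lam)| < ε →
      ε ≤ |(slope b lam (ξ, x) - slope b lam (ξ', x)) / (ratio b lam / b)| := by
    rcases hb.eq_or_lt with rfl | hb3
    · exact transversality_two h hneg
    · exact transversality_of_three_le hb3 h hneg
  have c0 : 0 < 2 * Real.pi * ratio b lam := by positivity
  refine ⟨min (ε * (2 * Real.pi * ratio b lam)) (4 * Real.pi ^ 2 * (ε * (ratio b lam / b))),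
    by positivity, fun ξ hξ ξ' hξ' hne x hx => ?_⟩
  have h1 := H ξ hξ ξ' hξ' hne x (by
    rw [abs_div, abs_of_pos c0, div_lt_iff₀ c0]
    exact hx.trans_le (min_le_left _ _))
  rw [abs_div, abs_of_pos q0, le_div_iff₀ q0] at h1
  rw [← mul_sub, abs_mul, abs_of_pos (by positivity : 0 < 4 * Real.pi ^ 2)]
  exact (min_le_right _ _).trans (mul_le_mul_of_nonneg_left h1 (by positivity))

/-- Measure of the sublevel sets of a transversal function: chop `[0,1)` into intervals on which
the derivative `D₁` varies by at most half of its lower bound. -/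
theorem volume_sublevel_le {D D₁ : ℝ → ℝ} {M ε R : ℝ} (hε : 0 < ε) (hR : 0 ≤ R)
    (K : ℕ) (hK : 2 * M ≤ ε * K) (hK0 : 0 < K)
    (hT : ∀ u v : ℝ, |D v - D u - (v - u) * D₁ u| ≤ M * (v - u) ^ 2)
    (htr : ∀ u : ℝ, |D u| < ε → ε ≤ |D₁ u|) :
    volume {x ∈ Ico (0 : ℝ) 1 | |D x| ≤ R} ≤ ENNReal.ofReal ((4 * K + 1) / ε * R) := by
  have hK0' : (0 : ℝ) < K := by exact_mod_cast hK0
  rcases le_or_gt ε R with hεR | hRε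
  · calc volume {x ∈ Ico (0 : ℝ) 1 | |D x| ≤ R} ≤ volume (Ico (0 : ℝ) 1) :=
          measure_mono fun x hx => hx.1
      _ = ENNReal.ofReal 1 := by simp
      _ ≤ _ := by
        apply ENNReal.ofReal_le_ofReal
        rw [div_mul_eq_mul_div, le_div_iff₀ hε]
        nlinarith
  · have hsub : {x ∈ Ico (0 : ℝ) 1 | |D x| ≤ R} ⊆ ⋃ j ∈ Finset.range K,
        {x | x ∈ Ico ((j : ℝ) / K) ((j + 1 : ℝ) / K) ∧ |D x| ≤ R} := by
      rintro x ⟨⟨h0, h1⟩, hx⟩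
      simp only [mem_iUnion, Finset.mem_range, exists_prop]
      refine ⟨⌊(K : ℝ) * x⌋₊, ?_, ⟨?_, ?_⟩, hx⟩
      · rw [Nat.floor_lt (by positivity)]; nlinarith
      · rw [div_le_iff₀ hK0', mul_comm x]; exact Nat.floor_le (by positivity)
      · rw [lt_div_iff₀ hK0', mul_comm x]; exact Nat.lt_floor_add_one _
    have hpiece : ∀ j : ℕ, volume {x | x ∈ Ico ((j : ℝ) / K) ((j + 1 : ℝ) / K) ∧ |D x| ≤ R}
        ≤ ENNReal.ofReal (4 * R / ε) := by
      intro j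
      refine (Real.volume_le_diam _).trans (Metric.ediam_le fun u hu v hv => ?_)
      rw [edist_dist, Real.dist_eq]
      apply ENNReal.ofReal_le_ofReal
      obtain ⟨⟨u0, u1⟩, uR⟩ := hu
      obtain ⟨⟨v0, v1⟩, vR⟩ := hv
      have hl : |v - u| ≤ 1 / K := by
        rw [add_div] at u1 v1
        rw [abs_le]; constructor <;> linarith
      have h1 := htr u (uR.trans_lt hRε)
      have h2 := hT u v
      have h3 : |(v - u) * D₁ u| ≤ |D v - D u| + M * (v - u) ^ 2 := by
        have := abs_sub (D v - D u) (D v - D u - (v - u) * D₁ u)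
        rw [sub_sub_cancel] at this; linarith
      have h4 : |D v - D u| ≤ 2 * R := (abs_sub _ _).trans (by linarith)
      rw [abs_mul] at h3
      have h5 : |v - u| * ε ≤ |v - u| * |D₁ u| := by gcongr
      have h6 : 2 * (M * (v - u) ^ 2) ≤ ε * |v - u| := by
        rw [← sq_abs]
        have : |v - u| * K ≤ 1 := by rwa [le_div_iff₀ hK0'] at hl
        calc 2 * (M * |v - u| ^ 2) = 2 * M * |v - u| ^ 2 := by ring
          _ ≤ ε * K * |v - u| ^ 2 := by gcongr
          _ = ε * |v - u| * (|v - u| * K) := by ring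
          _ ≤ ε * |v - u| * 1 := by gcongr
          _ = _ := mul_one _
      rw [le_div_iff₀ hε, abs_sub_comm u v]
      linarith
    calc _ ≤ _ := measure_mono hsub
      _ ≤ ∑ j ∈ Finset.range K, _ := measure_biUnion_finset_le _ _
      _ ≤ ∑ j ∈ Finset.range K, ENNReal.ofReal (4 * R / ε) :=
        Finset.sum_le_sum fun j _ => hpiece j
      _ = ENNReal.ofReal (K * (4 * R / ε)) := by
        rw [Finset.sum_const, Finset.card_range, nsmul_eq_mul, ENNReal.ofReal_mul hK0'.le,
          ENNReal.ofReal_natCast]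
      _ ≤ _ := by
        apply ENNReal.ofReal_le_ofReal
        have : 0 ≤ R / ε := by positivity
        calc (K : ℝ) * (4 * R / ε) = 4 * K * (R / ε) := by ring
          _ ≤ (4 * K + 1) * (R / ε) := by nlinarith
          _ = _ := by ring

/-- Points with different first digits: uniform linear bound for the measure of the set of `x` for
which `Θ_0(ξ, x)` and `Θ_0(ξ', x)` are `R`-close. -/
theorem exists_volume_close_le {b : ℕ} (hb : 2 ≤ b) {lam : ℝ}
    (h : 1 < (b : ℝ) * lam) (hneg : hFun b lam < 0) :
    ∃ C : ℝ, 0 < C ∧ ∀ R : ℝ, 0 ≤ R → ∀ ξ ∈ Ico (0 : ℝ) 1, ∀ ξ' ∈ Ico (0 : ℝ) 1,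
      ⌊(b : ℝ) * ξ⌋ ≠ ⌊(b : ℝ) * ξ'⌋ →
      volume {x ∈ Ico (0 : ℝ) 1 | |Theta b lam 0 (ξ, x) - Theta b lam 0 (ξ', x)| ≤ R}
        ≤ ENNReal.ofReal (C * R) := by
  obtain ⟨ε, hε, H⟩ := transversality hb h hneg
  set M₀ := ratio b lam / (1 - ratio b lam) * (24 * Real.pi ^ 3)
  obtain ⟨K, hK⟩ := exists_nat_ge (2 * (2 * M₀) / ε)
  rw [div_le_iff₀ hε] at hK
  refine ⟨(4 * (K + 1 : ℕ) + 1) / ε, by positivity, fun R hR ξ hξ ξ' hξ' hne => ?_⟩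
  refine volume_sublevel_le (D := fun x => Theta b lam 0 (ξ, x) - Theta b lam 0 (ξ', x))
    (D₁ := fun x => 4 * Real.pi ^ 2 * slope b lam (ξ, x) - 4 * Real.pi ^ 2 * slope b lam (ξ', x))
    (M := 2 * M₀) hε hR (K + 1) ?_ (Nat.succ_pos K) (fun u v => ?_) (H ξ hξ ξ' hξ' hne)
  · push_cast; linarith
  · have t1 := abs_Theta_zero_add_sub_le hb h ξ u (v - u)
    have t2 := abs_Theta_zero_add_sub_le hb h ξ' u (v - u)
    rw [add_sub_cancel] at t1 t2
    have := (abs_sub _ _).trans (add_le_add t1 t2)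
    calc _ = _ := by congr 1; ring
      _ ≤ _ := this
      _ = _ := by simp only [M₀]; ring

/-! ### Pair correlations -/

/-- The indicator of the triples `(ξ, ξ', x)` with `|Θ_0(ξ, x) - Θ_0(ξ', x)| ≤ R`. -/
noncomputable def closeInd (b : ℕ) (lam R ξ ξ' x : ℝ) : ENNReal :=
  if |Theta b lam 0 (ξ, x) - Theta b lam 0 (ξ', x)| ≤ R then 1 else 0

theorem measurable_closeInd {b : ℕ} {lam : ℝ} (h : 1 < (b : ℝ) * lam) (R : ℝ) :
    Measurable fun p : (ℝ × ℝ) × ℝ => closeInd b lam R p.1.2 p.2 p.1.1 := by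
  have hm := measurable_Theta h 0
  refine Measurable.ite (measurableSet_le ?_ measurable_const) measurable_const measurable_const
  have h1 : Measurable fun p : (ℝ × ℝ) × ℝ => Theta b lam 0 (p.1.2, p.1.1) :=
    hm.comp (by fun_prop)
  have h2 : Measurable fun p : (ℝ × ℝ) × ℝ => Theta b lam 0 (p.2, p.1.1) :=
    hm.comp (by fun_prop)
  exact (continuous_abs.measurable).comp (h1.sub h2)

theorem floor_mul_add_div {b : ℕ} (hb : 2 ≤ b) (i : ℕ) {ξ : ℝ} (hξ : ξ ∈ Ico (0 : ℝ) 1) :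
    ⌊(b : ℝ) * (((i : ℝ) + ξ) / b)⌋ = (i : ℤ) := by
  have hb0 : (0 : ℝ) < b := by exact_mod_cast (by omega : 0 < b)
  rw [mul_div_cancel₀ _ hb0.ne', Int.floor_natCast_add, Int.floor_eq_zero_iff.mpr hξ, add_zero]

theorem baker_add_div {b : ℕ} (hb : 2 ≤ b) (i : ℕ) {ξ : ℝ} (x : ℝ) (hξ : ξ ∈ Ico (0 : ℝ) 1) :
    baker b (((i : ℝ) + ξ) / b, x) = (ξ, ((i : ℝ) + x) / b) := by
  have hb0 : (0 : ℝ) < b := by exact_mod_cast (by omega : 0 < b)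
  simp only [baker]
  rw [floor_mul_add_div hb i hξ, mul_div_cancel₀ _ hb0.ne', Int.fract_natCast_add,
    Int.fract_eq_self.mpr hξ, Int.cast_natCast, add_comm x]

theorem closeInd_same_digit {b : ℕ} (hb : 2 ≤ b) {lam : ℝ} (h : 1 < (b : ℝ) * lam) (R : ℝ)
    (i : ℕ) {ξ ξ' : ℝ} (x : ℝ) (hξ : ξ ∈ Ico (0 : ℝ) 1) (hξ' : ξ' ∈ Ico (0 : ℝ) 1) :
    closeInd b lam R (((i : ℝ) + ξ) / b) (((i : ℝ) + ξ') / b) x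
      = closeInd b lam (R / ratio b lam) ξ ξ' (((i : ℝ) + x) / b) := by
  have g0 := ratio_pos h
  unfold closeInd
  rw [Theta_zero_baker h (_, x), Theta_zero_baker h (((i : ℝ) + ξ') / b, x),
    baker_add_div hb i x hξ, baker_add_div hb i x hξ', add_sub_add_left_eq_sub, ← mul_sub,
    abs_mul, abs_of_pos g0]
  simp only [le_div_iff₀ g0, mul_comm]

/-- The probability that `Θ_0(ξ, x)` and `Θ_0(ξ', x)` are `R`-close, for independent and uniformly
distributed `ξ`, `ξ'` and `x`. -/
noncomputable def pairCorr (b : ℕ) (lam R : ℝ) : ENNReal :=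
  ∫⁻ x in Ico (0 : ℝ) 1, ∫⁻ ξ in Ico (0 : ℝ) 1, ∫⁻ ξ' in Ico (0 : ℝ) 1, closeInd b lam R ξ ξ' x

theorem lintegral_Ico_const (c : ENNReal) : ∫⁻ _ in Ico (0 : ℝ) 1, c = c := by
  simp

theorem lintegral_Ico_le {f : ℝ → ENNReal} {c : ENNReal} (hf : ∀ x ∈ Ico (0 : ℝ) 1, f x ≤ c) :
    ∫⁻ x in Ico (0 : ℝ) 1, f x ≤ c :=
  (setLIntegral_mono' measurableSet_Ico hf).trans_eq (lintegral_Ico_const c)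

theorem closeInd_le_one (b : ℕ) (lam R ξ ξ' x : ℝ) : closeInd b lam R ξ ξ' x ≤ 1 := by
  unfold closeInd; split_ifs <;> simp

theorem pairCorr_le_one (b : ℕ) (lam R : ℝ) : pairCorr b lam R ≤ 1 :=
  lintegral_Ico_le fun _ _ => lintegral_Ico_le fun _ _ => lintegral_Ico_le fun _ _ =>
    closeInd_le_one _ _ _ _ _ _

/-- Averaging over the `b` inverse branches of `x ↦ b x mod 1` preserves integrals. -/
theorem lintegral_sum_branches {m : ℕ} (hm : 0 < m) {f : ℝ → ENNReal} (hf : Measurable f) :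
    ∫⁻ x in Ico (0 : ℝ) 1, ∑ i ∈ Finset.range m, (m : ENNReal)⁻¹ * f (((i : ℝ) + x) / m)
      = ∫⁻ x in Ico (0 : ℝ) 1, f x := by
  rw [lintegral_Ico_eq_sum m hm f, lintegral_finsetSum]
  · refine Finset.sum_congr rfl fun i _ => ?_
    rw [lintegral_const_mul']
    simp [hm.ne']
  · intro i _
    exact (hf.comp (by fun_prop)).const_mul _

/-- Renormalization of the pair correlation: pairs with the same first digit are magnified by
`1 / γ`, and pairs with different first digits are transversal. -/
theorem exists_pairCorr_le_add {b : ℕ} (hb : 2 ≤ b) {lam : ℝ}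
    (h : 1 < (b : ℝ) * lam) (hneg : hFun b lam < 0) :
    ∃ C : ℝ, 0 < C ∧ ∀ R : ℝ, 0 ≤ R →
      pairCorr b lam R ≤ (b : ENNReal)⁻¹ * pairCorr b lam (R / ratio b lam)
        + ENNReal.ofReal (C * R) := by
  obtain ⟨C, hC, H⟩ := exists_volume_close_le hb h hneg
  refine ⟨C, hC, fun R hR => ?_⟩
  have hb0 : 0 < b := by omega
  have hbinv : (b : ENNReal)⁻¹ ≠ ⊤ := by simp [hb0.ne']
  set A : ℝ → ℝ → ℝ → ENNReal := fun x ξ ξ' =>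
    if ⌊(b : ℝ) * ξ⌋ = ⌊(b : ℝ) * ξ'⌋ then closeInd b lam R ξ ξ' x else 0 with hA
  set B : ℝ → ℝ → ℝ → ENNReal := fun x ξ ξ' =>
    if ⌊(b : ℝ) * ξ⌋ = ⌊(b : ℝ) * ξ'⌋ then 0 else closeInd b lam R ξ ξ' x with hB
  have hdig : MeasurableSet {p : (ℝ × ℝ) × ℝ | ⌊(b : ℝ) * p.1.2⌋ = ⌊(b : ℝ) * p.2⌋} :=
    measurableSet_eq_fun (Int.measurable_floor.comp (by fun_prop))
      (Int.measurable_floor.comp (by fun_prop))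
  have mA : Measurable fun p : (ℝ × ℝ) × ℝ => A p.1.1 p.1.2 p.2 :=
    Measurable.ite hdig (measurable_closeInd h R) measurable_const
  have mB : Measurable fun p : (ℝ × ℝ) × ℝ => B p.1.1 p.1.2 p.2 :=
    Measurable.ite hdig measurable_const (measurable_closeInd h R)
  have mA2 : Measurable fun p : ℝ × ℝ => ∫⁻ ξ' in Ico (0 : ℝ) 1, A p.1 p.2 ξ' :=
    mA.lintegral_prod_right'
  have mA3 : Measurable fun x => ∫⁻ ξ in Ico (0 : ℝ) 1, ∫⁻ ξ' in Ico (0 : ℝ) 1, A x ξ ξ' :=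
    mA2.lintegral_prod_right'
  have hsplit : pairCorr b lam R
      = (∫⁻ x in Ico (0 : ℝ) 1, ∫⁻ ξ in Ico (0 : ℝ) 1, ∫⁻ ξ' in Ico (0 : ℝ) 1, A x ξ ξ')
      + ∫⁻ x in Ico (0 : ℝ) 1, ∫⁻ ξ in Ico (0 : ℝ) 1, ∫⁻ ξ' in Ico (0 : ℝ) 1, B x ξ ξ' := by
    rw [← lintegral_add_left mA3, pairCorr]
    refine lintegral_congr fun x => ?_
    have m2 : Measurable fun ξ => ∫⁻ ξ' in Ico (0 : ℝ) 1, A x ξ ξ' :=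
      mA2.comp measurable_prodMk_left
    rw [← lintegral_add_left m2]
    refine lintegral_congr fun ξ => ?_
    have m1 : Measurable (A x ξ) := mA.comp (measurable_prodMk_left (x := (x, ξ)))
    rw [← lintegral_add_left m1]
    refine lintegral_congr fun ξ' => ?_
    simp only [hA, hB]
    split_ifs <;> simp
  rw [hsplit]
  refine add_le_add ?_ ?_
  · set Ψ : ℝ → ENNReal := fun x => ∫⁻ ξ in Ico (0 : ℝ) 1, ∫⁻ ξ' in Ico (0 : ℝ) 1,
      closeInd b lam (R / ratio b lam) ξ ξ' x with hΨ
    have mΨ : Measurable Ψ := by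
      have := (measurable_closeInd h (R / ratio b lam)).lintegral_prod_right'
        (ν := volume.restrict (Ico (0 : ℝ) 1))
      exact this.lintegral_prod_right' (ν := volume.restrict (Ico (0 : ℝ) 1))
    have key : ∀ x, ∫⁻ ξ in Ico (0 : ℝ) 1, ∫⁻ ξ' in Ico (0 : ℝ) 1, A x ξ ξ'
        = (b : ENNReal)⁻¹ * ∑ i ∈ Finset.range b, (b : ENNReal)⁻¹ * Ψ (((i : ℝ) + x) / b) := by
      intro x
      rw [lintegral_Ico_eq_sum b hb0, Finset.mul_sum]
      refine Finset.sum_congr rfl fun i hi => ?_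
      congr 1
      rw [hΨ, ← lintegral_const_mul' _ _ hbinv]
      refine setLIntegral_congr_fun measurableSet_Ico fun ξ hξ => ?_
      rw [lintegral_Ico_eq_sum b hb0, Finset.sum_eq_single_of_mem i hi]
      · congr 1
        refine setLIntegral_congr_fun measurableSet_Ico fun ξ' hξ' => ?_
        simp only [hA, floor_mul_add_div hb i hξ, floor_mul_add_div hb i hξ', if_true]
        exact closeInd_same_digit hb h R i x hξ hξ'
      · intro j _ hji
        rw [setLIntegral_congr_fun (g := fun _ => 0) measurableSet_Ico, lintegral_zero, mul_zero]
        intro ξ' hξ'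
        simp only [hA, floor_mul_add_div hb i hξ, floor_mul_add_div hb j hξ']
        rw [if_neg (by exact_mod_cast hji.symm)]
    simp_rw [key]
    rw [lintegral_const_mul' _ _ hbinv, lintegral_sum_branches hb0 mΨ]
    rfl
  · have mB2 : Measurable fun p : ℝ × ℝ => ∫⁻ ξ' in Ico (0 : ℝ) 1, B p.1 p.2 ξ' :=
      mB.lintegral_prod_right'
    rw [lintegral_lintegral_swap mB2.aemeasurable]
    refine lintegral_Ico_le fun ξ hξ => ?_
    have mB3 : Measurable (Function.uncurry fun x ξ' => B x ξ ξ') :=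
      mB.comp (by fun_prop : Measurable fun p : ℝ × ℝ => ((p.1, ξ), p.2))
    rw [lintegral_lintegral_swap mB3.aemeasurable]
    refine lintegral_Ico_le fun ξ' hξ' => ?_
    by_cases hd : ⌊(b : ℝ) * ξ⌋ = ⌊(b : ℝ) * ξ'⌋
    · simp [hB, hd]
    · refine le_trans (le_of_eq ?_) (H R hR ξ hξ ξ' hξ' hd)
      have hm := measurable_Theta h 0
      have hS : MeasurableSet {x | |Theta b lam 0 (ξ, x) - Theta b lam 0 (ξ', x)| ≤ R} := by
        refine measurableSet_le ?_ measurable_const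
        exact (continuous_abs.measurable).comp
          ((hm.comp measurable_prodMk_left).sub (hm.comp measurable_prodMk_left))
      rw [show {x ∈ Ico (0 : ℝ) 1 | |Theta b lam 0 (ξ, x) - Theta b lam 0 (ξ', x)| ≤ R}
        = {x | |Theta b lam 0 (ξ, x) - Theta b lam 0 (ξ', x)| ≤ R} ∩ Ico 0 1 from
          inter_comm _ _, ← Measure.restrict_apply hS, ← lintegral_indicator_one hS]
      refine lintegral_congr fun x => ?_
      simp only [hB, if_neg hd, closeInd, indicator, mem_ofPred_eq, Pi.one_apply]

/-- The pair correlation is at most linear in the distance. -/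
theorem exists_pairCorr_le {b : ℕ} (hb : 2 ≤ b) {lam : ℝ}
    (h : 1 < (b : ℝ) * lam) (hlam : lam < 1) (hneg : hFun b lam < 0) :
    ∃ C : ℝ, 0 < C ∧ ∀ R : ℝ, 0 ≤ R → pairCorr b lam R ≤ ENNReal.ofReal (C * R) := by
  obtain ⟨C, hC, H⟩ := exists_pairCorr_le_add hb h hneg
  have g0 := ratio_pos h
  have hb0 : (0 : ℝ) < b := by exact_mod_cast (by omega : 0 < b)
  have hb1 : (1 : ℝ) < b := by exact_mod_cast (by omega : 1 < b)
  have hl : 0 < 1 - lam := by linarith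
  have hl0 : 0 < lam := by
    by_contra! hl
    nlinarith
  have claim : ∀ n : ℕ, ∀ R : ℝ, 0 ≤ R →
      pairCorr b lam R ≤ ENNReal.ofReal ((b : ℝ)⁻¹ ^ n + C * R / (1 - lam)) := by
    intro n
    induction n with
    | zero =>
      intro R hR
      refine (pairCorr_le_one b lam R).trans ?_
      rw [← ENNReal.ofReal_one]
      apply ENNReal.ofReal_le_ofReal
      have : 0 ≤ C * R / (1 - lam) := by positivity
      rw [pow_zero]; linarith
    | succ n ih =>
      intro R hR
      have hR' : 0 ≤ R / ratio b lam := by positivity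
      refine (H R hR).trans ((add_le_add_left (mul_le_mul_right (ih _ hR') _) _).trans
        (le_of_eq ?_))
      have hbe : (b : ENNReal)⁻¹ = ENNReal.ofReal (b : ℝ)⁻¹ := by
        rw [ENNReal.ofReal_inv_of_pos hb0, ENNReal.ofReal_natCast]
      rw [hbe, ← ENNReal.ofReal_mul (by positivity),
        ← ENNReal.ofReal_add (by positivity) (by positivity)]
      congr 1
      unfold ratio
      rw [pow_succ', div_div_eq_mul_div, div_one]
      field_simp
      ring
  refine ⟨C / (1 - lam), by positivity, fun R hR => ?_⟩
  have ht : Filter.Tendsto (fun n : ℕ => ENNReal.ofReal ((b : ℝ)⁻¹ ^ n + C * R / (1 - lam)))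
      Filter.atTop (nhds (ENNReal.ofReal (0 + C * R / (1 - lam)))) := by
    refine (ENNReal.continuous_ofReal.tendsto _).comp (Filter.Tendsto.add_const _ ?_)
    exact tendsto_pow_atTop_nhds_zero_of_lt_one (by positivity) (inv_lt_one_of_one_lt₀ hb1)
  have := ge_of_tendsto' ht fun n => claim n R hR
  rwa [zero_add, mul_div_right_comm] at this

/-! ### Fubini on the square and invariance of Lebesgue measure -/

theorem measurableSet_unitSquare : MeasurableSet unitSquare :=
  measurableSet_Ico.prod measurableSet_Ico

theorem lintegral_unitSquare {f : ℝ × ℝ → ENNReal} (hf : Measurable f) :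
    ∫⁻ p in unitSquare, f p = ∫⁻ x in Ico (0 : ℝ) 1, ∫⁻ ξ in Ico (0 : ℝ) 1, f (ξ, x) := by
  rw [unitSquare, Measure.volume_eq_prod, ← Measure.prod_restrict, lintegral_prod_symm' _ hf]

/-- The baker map preserves Lebesgue measure on the unit square. -/
theorem lintegral_baker_iterate {b : ℕ} (hb : 2 ≤ b) (N : ℕ) {f : ℝ × ℝ → ENNReal}
    (hf : Measurable f) :
    ∫⁻ p in unitSquare, f ((baker b)^[N] p) = ∫⁻ p in unitSquare, f p := by
  have hb0 : 0 < b := by omega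
  have hbinv : (b : ENNReal)⁻¹ ≠ ⊤ := by simp [hb0.ne']
  induction N with
  | zero => rfl
  | succ N ih =>
    rw [← ih]
    set g : ℝ × ℝ → ENNReal := fun p => f ((baker b)^[N] p) with hg
    have mg : Measurable g := hf.comp ((measurable_baker b).iterate N)
    have : ∀ p, f ((baker b)^[N + 1] p) = g (baker b p) := fun p => rfl
    simp_rw [this]
    have mg' : Measurable fun p => g (baker b p) := mg.comp (measurable_baker b)
    rw [lintegral_unitSquare mg', lintegral_unitSquare mg,
      ← lintegral_sum_branches hb0 mg.lintegral_prod_left']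
    refine lintegral_congr fun x => ?_
    rw [lintegral_Ico_eq_sum b hb0]
    refine Finset.sum_congr rfl fun i _ => ?_
    congr 1
    refine setLIntegral_congr_fun measurableSet_Ico fun ξ hξ => ?_
    simp only [baker_add_div hb i x hξ]

theorem volume_baker_iterate_preimage {b : ℕ} (hb : 2 ≤ b) (N : ℕ) {A : Set (ℝ × ℝ)}
    (hA : MeasurableSet A) :
    volume (unitSquare ∩ (baker b)^[N] ⁻¹' A) = volume (unitSquare ∩ A) := by
  have := lintegral_baker_iterate hb N (f := A.indicator 1) (measurable_one.indicator hA)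
  have e : ∀ p, A.indicator (1 : ℝ × ℝ → ENNReal) ((baker b)^[N] p)
      = ((baker b)^[N] ⁻¹' A).indicator 1 p := fun p => rfl
  simp_rw [e] at this
  have hA' := ((measurable_baker b).iterate N) hA
  rw [lintegral_indicator_one hA, lintegral_indicator_one hA', Measure.restrict_apply hA,
    Measure.restrict_apply hA'] at this
  rw [inter_comm, this, inter_comm]

theorem volume_eq_sum_cylinders (m : ℕ) (hm : 0 < m) {G : Set ℝ} (hG : MeasurableSet G)
    (hG1 : G ⊆ Ico 0 1) :
    volume G = ∑ j ∈ Finset.range m,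
      (m : ENNReal)⁻¹ * volume {ξ ∈ Ico (0 : ℝ) 1 | ((j : ℝ) + ξ) / m ∈ G} := by
  have := lintegral_Ico_eq_sum m hm (G.indicator 1)
  rw [lintegral_indicator_one hG, Measure.restrict_apply hG, inter_eq_left.mpr hG1] at this
  rw [this]
  refine Finset.sum_congr rfl fun j _ => ?_
  congr 1
  have hG' : MeasurableSet {ξ : ℝ | ((j : ℝ) + ξ) / m ∈ G} :=
    (by fun_prop : Measurable fun ξ : ℝ => ((j : ℝ) + ξ) / m) hG
  have e : ∀ ξ : ℝ, G.indicator (1 : ℝ → ENNReal) (((j : ℝ) + ξ) / m)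
      = {ξ : ℝ | ((j : ℝ) + ξ) / m ∈ G}.indicator 1 ξ := fun ξ => rfl
  simp_rw [e]
  rw [lintegral_indicator_one hG', Measure.restrict_apply hG', inter_comm]
  rfl

/-! ### Heavy balls for the law of `Θ_0` -/

/-- The mass that the law of `Θ_0(·, x)` gives to the interval of radius `R` about `Θ_0(ξ, x)`,
where `p = (ξ, x)`. -/
noncomputable def ballMass (b : ℕ) (lam R : ℝ) (p : ℝ × ℝ) : ENNReal :=
  ∫⁻ ξ' in Ico (0 : ℝ) 1, closeInd b lam R p.1 ξ' p.2

theorem measurable_closeInd_fst {b : ℕ} {lam : ℝ} (h : 1 < (b : ℝ) * lam) (R : ℝ) :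
    Measurable fun q : (ℝ × ℝ) × ℝ => closeInd b lam R q.1.1 q.2 q.1.2 := by
  have hg : Measurable fun q : (ℝ × ℝ) × ℝ => ((q.1.2, q.1.1), q.2) := by fun_prop
  have := (measurable_closeInd h R).comp hg
  exact this

theorem measurable_ballMass {b : ℕ} {lam : ℝ} (h : 1 < (b : ℝ) * lam) (R : ℝ) :
    Measurable (ballMass b lam R) := by
  have := measurable_closeInd_fst h R
  unfold ballMass
  exact this.lintegral_prod_right'

theorem lintegral_ballMass {b : ℕ} {lam : ℝ} (h : 1 < (b : ℝ) * lam) (R : ℝ) :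
    ∫⁻ p in unitSquare, ballMass b lam R p = pairCorr b lam R :=
  lintegral_unitSquare (measurable_ballMass h R)

theorem volume_le_ballMass {b : ℕ} {lam : ℝ} (h : 1 < (b : ℝ) * lam) (R ξ x : ℝ) {S : Set ℝ}
    (hS : S ⊆ Ico 0 1)
    (hc : ∀ ξ' ∈ S, |Theta b lam 0 (ξ, x) - Theta b lam 0 (ξ', x)| ≤ R) :
    volume S ≤ ballMass b lam R (ξ, x) := by
  have hm := measurable_Theta h 0
  have hT : MeasurableSet {ξ' | |Theta b lam 0 (ξ, x) - Theta b lam 0 (ξ', x)| ≤ R} :=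
    measurableSet_le ((continuous_abs.measurable).comp
      (measurable_const.sub (hm.comp measurable_prodMk_right))) measurable_const
  have e : ballMass b lam R (ξ, x)
      = volume ({ξ' | |Theta b lam 0 (ξ, x) - Theta b lam 0 (ξ', x)| ≤ R} ∩ Ico 0 1) := by
    rw [← Measure.restrict_apply hT, ← lintegral_indicator_one hT, ballMass]
    refine lintegral_congr fun ξ' => ?_
    simp only [closeInd, indicator, mem_ofPred_eq, Pi.one_apply]
  rw [e]
  exact measure_mono fun ξ' h' => ⟨hc ξ' h', hS h'⟩

/-- Markov's inequality on the unit square. -/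
theorem volume_lt_le_of_lintegral {f : ℝ × ℝ → ENNReal} (hf : Measurable f) {τ c : ℝ}
    (hτ : 0 < τ) (hfc : ∫⁻ p in unitSquare, f p ≤ ENNReal.ofReal c) :
    volume (unitSquare ∩ {p | ENNReal.ofReal τ < f p}) ≤ ENNReal.ofReal (c / τ) := by
  have h0 : ENNReal.ofReal τ ≠ 0 := by simpa using hτ
  have h1 := (mul_meas_ge_le_lintegral (μ := volume.restrict unitSquare) hf
    (ENNReal.ofReal τ)).trans hfc
  rw [Measure.restrict_apply (measurableSet_le measurable_const hf)] at h1
  rw [ENNReal.ofReal_div_of_pos hτ, ENNReal.le_div_iff_mul_le (Or.inl h0) (Or.inl (by simp)),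
    mul_comm]
  refine le_trans (mul_le_mul_right (measure_mono ?_) _) h1
  rintro p ⟨hp, hp'⟩
  exact ⟨(show ENNReal.ofReal τ < f p from hp').le, hp⟩

/-! ### Sets that are dense in a cylinder -/

/-- The proportion of the set `E` in the horizontal segment of the `m`-adic cylinder which
contains the point `p`. -/
noncomputable def cylDensity (m : ℕ) (E : Set (ℝ × ℝ)) (p : ℝ × ℝ) : ENNReal :=
  ∫⁻ ξ in Ico (0 : ℝ) 1, E.indicator 1 (((⌊(m : ℝ) * p.1⌋ : ℝ) + ξ) / m, p.2)

theorem measurable_cylDensity (m : ℕ) {E : Set (ℝ × ℝ)} (hE : MeasurableSet E) :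
    Measurable (cylDensity m E) := by
  have hfl : Measurable fun p : (ℝ × ℝ) × ℝ => (⌊(m : ℝ) * p.1.1⌋ : ℝ) :=
    (measurable_from_top (f := fun n : ℤ => (n : ℝ))).comp
      (Int.measurable_floor.comp (by fun_prop))
  have hg : Measurable fun p : (ℝ × ℝ) × ℝ =>
      ((((⌊(m : ℝ) * p.1.1⌋ : ℝ) + p.2) / m, p.1.2) : ℝ × ℝ) :=
    ((hfl.add measurable_snd).div_const _).prodMk (by fun_prop)
  have : Measurable fun p : (ℝ × ℝ) × ℝ =>
      E.indicator (1 : ℝ × ℝ → ENNReal) (((⌊(m : ℝ) * p.1.1⌋ : ℝ) + p.2) / m, p.1.2) :=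
    (measurable_one.indicator hE).comp hg
  exact this.lintegral_prod_right'

theorem floor_mul_cyl {m : ℕ} (hm : 0 < m) (j : ℕ) {ξ : ℝ} (hξ : ξ ∈ Ico (0 : ℝ) 1) :
    (⌊(m : ℝ) * (((j : ℝ) + ξ) / m)⌋ : ℝ) = j := by
  have hm0 : (0 : ℝ) < m := by exact_mod_cast hm
  rw [mul_div_cancel₀ _ hm0.ne', Int.floor_natCast_add, Int.floor_eq_zero_iff.mpr hξ, add_zero,
    Int.cast_natCast]

theorem lintegral_cylDensity {m : ℕ} (hm : 0 < m) {E : Set (ℝ × ℝ)} (hE : MeasurableSet E)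
    (hE1 : E ⊆ unitSquare) :
    ∫⁻ p in unitSquare, cylDensity m E p = volume E := by
  have hi : Measurable (E.indicator (1 : ℝ × ℝ → ENNReal)) := measurable_one.indicator hE
  have : volume E = ∫⁻ p in unitSquare, E.indicator 1 p := by
    rw [lintegral_indicator_one hE, Measure.restrict_apply hE, inter_eq_left.mpr hE1]
  rw [this, lintegral_unitSquare (measurable_cylDensity m hE), lintegral_unitSquare hi]
  refine lintegral_congr fun x => ?_
  rw [lintegral_Ico_eq_sum m hm, lintegral_Ico_eq_sum m hm]
  refine Finset.sum_congr rfl fun j _ => ?_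
  congr 1
  refine (setLIntegral_congr_fun measurableSet_Ico fun ξ hξ => ?_).trans (lintegral_Ico_const _)
  simp only [cylDensity, floor_mul_cyl hm j hξ]

/-! ### Improving small ball estimates -/

/-- The horizontal section at height `x` of the complement of `E` in the unit square. -/
def goodSection (E : Set (ℝ × ℝ)) (x : ℝ) : Set ℝ := {ξ ∈ Ico (0 : ℝ) 1 | (ξ, x) ∉ E}

theorem measurableSet_goodSection {E : Set (ℝ × ℝ)} (hE : MeasurableSet E) (x : ℝ) :
    MeasurableSet (goodSection E x) :=
  measurableSet_Ico.inter (measurable_prodMk_right hE).compl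

/-- The set `E` is an exceptional set of measure at most `M` outside of which, uniformly in
`z ∈ [-1, 1]` and in `x`, the law of `Θ_z(·, x)` gives mass at most `β` to each interval of
length `r`. -/
structure IsExceptional (b : ℕ) (lam r M β : ℝ) (E : Set (ℝ × ℝ)) : Prop where
  subset : E ⊆ unitSquare
  measurableSet : MeasurableSet E
  volume_le : volume E ≤ ENNReal.ofReal M
  small_ball : ∀ z : ℝ, |z| ≤ 1 → ∀ x ∈ Ico (0 : ℝ) 1, ∀ a : ℝ,
    volume (goodSection E x ∩ {ξ | Theta b lam z (ξ, x) ∈ Icc a (a + r)}) ≤ ENNReal.ofReal β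

/-- Small ball estimates with loss `r ^ (-κ)` outside of sets of polynomially small measure. -/
def HasSmallBalls (b : ℕ) (lam κ : ℝ) : Prop :=
  ∃ δ C : ℝ, 0 < δ ∧ 0 < C ∧ ∀ r : ℝ, 0 < r → r ≤ 1 →
    ∃ E : Set (ℝ × ℝ), IsExceptional b lam r (C * r ^ δ) (C * r ^ (1 - κ)) E

theorem hasSmallBalls_one (b : ℕ) (lam : ℝ) : HasSmallBalls b lam 1 := by
  refine ⟨1, 1, one_pos, one_pos, fun r hr _ => ⟨∅, empty_subset _, MeasurableSet.empty, by simp,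
    fun z _ x _ a => ?_⟩⟩
  calc _ ≤ volume (Ico (0 : ℝ) 1) := measure_mono fun ξ hξ => hξ.1.1
    _ = _ := by simp

/-- It suffices to consider the scales `q ^ N`. -/
theorem hasSmallBalls_of_pow {b : ℕ} {lam κ q : ℝ} (hκ : κ ≤ 1) (hq0 : 0 < q) (hq1 : q < 1)
    {δ C : ℝ} (hδ : 0 < δ) (hC : 0 < C)
    (H : ∀ N : ℕ, ∃ E : Set (ℝ × ℝ),
      IsExceptional b lam (q ^ N) (C * (q ^ N) ^ δ) (C * (q ^ N) ^ (1 - κ)) E) :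
    HasSmallBalls b lam κ := by
  refine ⟨δ, C * (q⁻¹ ^ δ + q⁻¹ ^ (1 - κ)), hδ, by positivity, fun r hr hr1 => ?_⟩
  obtain ⟨N, hN1, hN2⟩ := exists_nat_pow_near_of_lt_one hr hr1 hq0 hq1
  have hqr : q ^ N ≤ q⁻¹ * r := by
    rw [le_inv_mul_iff₀ hq0, ← pow_succ']; exact hN1.le
  have hpow : ∀ e : ℝ, 0 ≤ e → (q ^ N) ^ e ≤ q⁻¹ ^ e * r ^ e := fun e he => by
    rw [← Real.mul_rpow (by positivity) hr.le]
    exact Real.rpow_le_rpow (by positivity) hqr he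
  have p1 : 0 < q⁻¹ ^ δ := by positivity
  have p2 : 0 < q⁻¹ ^ (1 - κ) := by positivity
  obtain ⟨E, hE⟩ := H N
  refine ⟨E, hE.subset, hE.measurableSet, hE.volume_le.trans (ENNReal.ofReal_le_ofReal ?_),
    fun z hz x hx a => le_trans (measure_mono ?_) ((hE.small_ball z hz x hx a).trans
      (ENNReal.ofReal_le_ofReal ?_))⟩
  · rw [mul_assoc]
    refine mul_le_mul_of_nonneg_left ((hpow δ hδ.le).trans ?_) hC.le
    exact mul_le_mul_of_nonneg_right (by linarith) (by positivity)
  · rintro ξ ⟨h1, h2⟩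
    exact ⟨h1, h2.1, h2.2.trans (by linarith)⟩
  · rw [mul_assoc]
    refine mul_le_mul_of_nonneg_left ((hpow (1 - κ) (by linarith)).trans ?_) hC.le
    exact mul_le_mul_of_nonneg_right (by linarith) (by positivity)

theorem volume_inter_Icc_le {S : Set ℝ} {f : ℝ → ℝ} {r : ℝ} {β : ENNReal}
    (H : ∀ a : ℝ, volume (S ∩ {ξ | f ξ ∈ Icc a (a + r)}) ≤ β) (K : ℕ) (a : ℝ) :
    volume (S ∩ {ξ | f ξ ∈ Icc a (a + (K + 1 : ℕ) * r)}) ≤ (K + 1 : ℕ) * β := by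
  induction K with
  | zero => simpa using H a
  | succ K ih =>
    have hsub : S ∩ {ξ | f ξ ∈ Icc a (a + (K + 1 + 1 : ℕ) * r)} ⊆
        (S ∩ {ξ | f ξ ∈ Icc a (a + (K + 1 : ℕ) * r)}) ∪
        (S ∩ {ξ | f ξ ∈ Icc (a + (K + 1 : ℕ) * r) (a + (K + 1 : ℕ) * r + r)}) := by
      rintro ξ ⟨h1, h2, h3⟩
      rcases le_total (f ξ) (a + (K + 1 : ℕ) * r) with h | h
      · exact Or.inl ⟨h1, h2, h⟩
      · refine Or.inr ⟨h1, h, h3.trans (le_of_eq ?_)⟩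
        push_cast; ring
    calc _ ≤ _ := measure_mono hsub
      _ ≤ _ := measure_union_le _ _
      _ ≤ (K + 1 : ℕ) * β + β := add_le_add ih (H _)
      _ = _ := by push_cast; ring

/-- The exceptional set at scale `(γ / b) ^ N`: the points whose `N`-cylinder is mostly filled by
the exceptional set `E₁` of scale `γ ^ N`, and the points which `B ^ N` maps to the centre of a
ball of radius `R` that is too heavy for the law of `Θ_0`. -/
def nextExceptional (b : ℕ) (lam : ℝ) (N : ℕ) (R τ : ℝ) (E₁ : Set (ℝ × ℝ)) : Set (ℝ × ℝ) :=
  (unitSquare ∩ {p | ENNReal.ofReal (1 / 2) < cylDensity (b ^ N) E₁ p}) ∪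
    (unitSquare ∩ (baker b)^[N] ⁻¹' {p | ENNReal.ofReal τ < ballMass b lam R p})

theorem volume_nextExceptional_le {b : ℕ} (hb : 2 ≤ b) {lam : ℝ} (h : 1 < (b : ℝ) * lam)
    (N : ℕ) {R τ M c : ℝ} (hτ : 0 < τ) (hM : 0 ≤ M) (hc : 0 ≤ c)
    (hpc : pairCorr b lam R ≤ ENNReal.ofReal c) {E₁ : Set (ℝ × ℝ)} (hE : MeasurableSet E₁)
    (hE1 : E₁ ⊆ unitSquare) (hEM : volume E₁ ≤ ENNReal.ofReal M) :
    volume (nextExceptional b lam N R τ E₁) ≤ ENNReal.ofReal (2 * M + c / τ) := by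
  have hm : 0 < b ^ N := pow_pos (by omega) N
  refine (measure_union_le _ _).trans ?_
  rw [ENNReal.ofReal_add (by positivity) (by positivity)]
  refine add_le_add ?_ ?_
  · refine (volume_lt_le_of_lintegral (measurable_cylDensity (b ^ N) hE) (by norm_num)
      ((lintegral_cylDensity hm hE hE1).trans_le hEM)).trans (ENNReal.ofReal_le_ofReal ?_)
    linarith
  · rw [volume_baker_iterate_preimage hb N (measurableSet_lt measurable_const
      (measurable_ballMass h R))]
    exact volume_lt_le_of_lintegral (measurable_ballMass h R) hτ
      ((lintegral_ballMass h R).trans_le hpc)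

theorem measurableSet_nextExceptional {b : ℕ} {lam : ℝ} (h : 1 < (b : ℝ) * lam) (N : ℕ)
    (R τ : ℝ) {E₁ : Set (ℝ × ℝ)} (hE : MeasurableSet E₁) :
    MeasurableSet (nextExceptional b lam N R τ E₁) :=
  (measurableSet_unitSquare.inter
    (measurableSet_lt measurable_const (measurable_cylDensity _ hE))).union
  (measurableSet_unitSquare.inter
    (((measurable_baker b).iterate N) (measurableSet_lt measurable_const
      (measurable_ballMass h R))))

/-- Values of `Θ_{z / b ^ N}` that are `b ^ (-N)`-close become values of `Θ_0` that are
`thickening * b ^ (-N)`-close: twice the Lipschitz constant in `z` is added. -/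
noncomputable def thickening (b : ℕ) (lam : ℝ) : ℝ :=
  1 + 2 * (12 * Real.pi ^ 2 / (1 - ratio b lam))

/-- Comparison on one cylinder of order `N`. A good point `ξ₀` of the cylinder with `Θ_z` in an
interval of length `(γ / b) ^ N` shows two things: by the choice of the second part of the
exceptional set, such good points have proportion at most `τ` in the cylinder; and at least half
of the cylinder is good at scale `γ ^ N`, with `Θ_z` in an interval of length `K γ ^ N`. -/
theorem volume_cylinder_le {b : ℕ} (hb : 2 ≤ b) {lam : ℝ} (h : 1 < (b : ℝ) * lam) (N j : ℕ)
    (hj : j < b ^ N) {τ : ℝ} {E₁ : Set (ℝ × ℝ)} (hE : MeasurableSet E₁) {K : ℝ}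
    (hK : 1 + 8 * Real.pi * (ratio b lam / (1 - ratio b lam)) ≤ K) {z x : ℝ} (hz : |z| ≤ 1)
    (hx : x ∈ Ico (0 : ℝ) 1) (a : ℝ) :
    volume {ξ ∈ Ico (0 : ℝ) 1 | ((j : ℝ) + ξ) / (b ^ N : ℕ) ∈
        goodSection (nextExceptional b lam N (thickening b lam * (b : ℝ)⁻¹ ^ N) τ E₁) x ∩
          {ξ | Theta b lam z (ξ, x) ∈ Icc a (a + (ratio b lam / b) ^ N)}}
      ≤ 2 * ENNReal.ofReal τ * volume {ξ ∈ Ico (0 : ℝ) 1 | ((j : ℝ) + ξ) / (b ^ N : ℕ) ∈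
        goodSection E₁ x ∩ {ξ | Theta b lam z (ξ, x) ∈
          Icc (a - 4 * Real.pi * (ratio b lam / (1 - ratio b lam)) * ratio b lam ^ N)
            (a - 4 * Real.pi * (ratio b lam / (1 - ratio b lam)) * ratio b lam ^ N
              + K * ratio b lam ^ N)}} := by
  have hm : 0 < b ^ N := pow_pos (by omega) N
  have hb1 : (1 : ℝ) ≤ b := by exact_mod_cast (by omega : 1 ≤ b)
  have hb0 : (0 : ℝ) < b := by linarith
  have g0 := ratio_pos h
  have g1 := ratio_lt_one h
  have gN : 0 < ratio b lam ^ N := by positivity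
  set R := thickening b lam * (b : ℝ)⁻¹ ^ N with hR
  set G := goodSection (nextExceptional b lam N R τ E₁) x ∩
          {ξ | Theta b lam z (ξ, x) ∈ Icc a (a + (ratio b lam / b) ^ N)} with hG
  set W := ratio b lam / (1 - ratio b lam) with hW
  have hW0 : 0 < W := div_pos g0 (by linarith)
  rcases Set.eq_empty_or_nonempty {ξ ∈ Ico (0 : ℝ) 1 | ((j : ℝ) + ξ) / (b ^ N : ℕ) ∈ G}
    with hemp | ⟨ξ₀, hξ₀, ⟨⟨hu, hne⟩, hΘ₀⟩⟩
  · rw [hemp, measure_empty]; exact zero_le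
  have hsq : (((j : ℝ) + ξ₀) / (b ^ N : ℕ), x) ∈ unitSquare := ⟨hu, hx⟩
  obtain ⟨c, y, hy, H⟩ := exists_cylinder hb h N j hj z x hx
  have hcast : ((b ^ N : ℕ) : ℝ) = (b : ℝ) ^ N := by push_cast; rfl
  have hdens : cylDensity (b ^ N) E₁ (((j : ℝ) + ξ₀) / (b ^ N : ℕ), x)
      ≤ ENNReal.ofReal (1 / 2) := by
    by_contra! hcon
    exact hne (Or.inl ⟨hsq, hcon⟩)
  have hball : ballMass b lam R (ξ₀, y) ≤ ENNReal.ofReal τ := by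
    by_contra! hcon
    refine hne (Or.inr ⟨hsq, ?_⟩)
    rw [mem_preimage, hcast, (H ξ₀ hξ₀).1]
    exact hcon
  -- the upper bound for the good points at the finer scale
  have hupper : volume {ξ ∈ Ico (0 : ℝ) 1 | ((j : ℝ) + ξ) / (b ^ N : ℕ) ∈ G}
      ≤ ENNReal.ofReal τ := by
    refine (volume_le_ballMass h R ξ₀ y (fun ξ hξ => hξ.1) ?_).trans hball
    rintro ξ ⟨hξ, -, hΘ⟩
    rw [mem_ofPred_eq, hcast, (H ξ hξ).2] at hΘ
    rw [mem_ofPred_eq, hcast, (H ξ₀ hξ₀).2] at hΘ₀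
    have d1 : |ratio b lam ^ N * (Theta b lam (z / (b : ℝ) ^ N) (ξ₀, y)
        - Theta b lam (z / (b : ℝ) ^ N) (ξ, y))| ≤ (ratio b lam / b) ^ N := by
      rw [mul_sub, abs_le]
      constructor <;> linarith [hΘ.1, hΘ.2, hΘ₀.1, hΘ₀.2]
    rw [abs_mul, abs_of_pos gN, div_eq_mul_inv (ratio b lam) (b : ℝ), mul_pow] at d1
    have d2 := le_of_mul_le_mul_left d1 gN
    have hzb : |z / (b : ℝ) ^ N| ≤ (b : ℝ)⁻¹ ^ N := by
      rw [abs_div, abs_of_pos (by positivity : 0 < (b : ℝ) ^ N), inv_pow, ← one_div]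
      gcongr
    set L := 12 * Real.pi ^ 2 / (1 - ratio b lam) with hL
    have hL0 : 0 < L := div_pos (by positivity) (by linarith)
    have l1 := (abs_Theta_sub_le hb h (z / (b : ℝ) ^ N) (ξ₀, y)).trans
      (mul_le_mul_of_nonneg_left hzb hL0.le)
    have l2 := (abs_Theta_sub_le hb h (z / (b : ℝ) ^ N) (ξ, y)).trans
      (mul_le_mul_of_nonneg_left hzb hL0.le)
    have hRe : R = (b : ℝ)⁻¹ ^ N + L * (b : ℝ)⁻¹ ^ N + L * (b : ℝ)⁻¹ ^ N := by
      rw [hR, thickening]; ring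
    rw [abs_le] at d2 l1 l2 ⊢
    rw [hRe]
    constructor <;> linarith [d2.1, d2.2, l1.1, l1.2, l2.1, l2.2]
  -- the lower bound for the good points at the coarser scale
  set S := {ξ ∈ Ico (0 : ℝ) 1 | ((j : ℝ) + ξ) / (b ^ N : ℕ) ∈
        goodSection E₁ x ∩ {ξ | Theta b lam z (ξ, x) ∈
          Icc (a - 4 * Real.pi * W * ratio b lam ^ N)
            (a - 4 * Real.pi * W * ratio b lam ^ N + K * ratio b lam ^ N)}} with hS
  set T := {ξ : ℝ | (((j : ℝ) + ξ) / (b ^ N : ℕ), x) ∈ E₁} with hT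
  have mT : MeasurableSet T :=
    (by fun_prop : Measurable fun ξ : ℝ => ((((j : ℝ) + ξ) / (b ^ N : ℕ), x) : ℝ × ℝ)) hE
  have hTvol : volume (T ∩ Ico 0 1) ≤ ENNReal.ofReal (1 / 2) := by
    refine le_trans (le_of_eq ?_) hdens
    rw [← Measure.restrict_apply mT, ← lintegral_indicator_one mT]
    refine lintegral_congr fun ξ => ?_
    simp only [floor_mul_cyl hm j hξ₀]
    rfl
  have hcover : Ico (0 : ℝ) 1 ⊆ (T ∩ Ico 0 1) ∪ S := by
    intro ξ hξ
    by_cases hξT : ξ ∈ T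
    · exact Or.inl ⟨hξT, hξ⟩
    refine Or.inr ⟨hξ, ⟨⟨?_, hξT⟩, ?_⟩⟩
    · have hj' : (j : ℝ) + 1 ≤ (b : ℝ) ^ N := by exact_mod_cast hj
      rw [hcast]
      refine ⟨div_nonneg (add_nonneg (Nat.cast_nonneg _) hξ.1) (by positivity), ?_⟩
      rw [div_lt_one (by positivity)]; linarith [hξ.2]
    · rw [mem_ofPred_eq, hcast, (H ξ hξ).2]
      rw [mem_ofPred_eq, hcast, (H ξ₀ hξ₀).2] at hΘ₀
      have t1 := abs_le.mp (abs_Theta_le h (z / (b : ℝ) ^ N) (ξ, y))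
      have t2 := abs_le.mp (abs_Theta_le h (z / (b : ℝ) ^ N) (ξ₀, y))
      have t3 : Theta b lam (z / (b : ℝ) ^ N) (ξ, y)
          ≤ Theta b lam (z / (b : ℝ) ^ N) (ξ₀, y) + 4 * Real.pi * W := by linarith [t1.2, t2.1]
      have t4 : Theta b lam (z / (b : ℝ) ^ N) (ξ₀, y)
          ≤ Theta b lam (z / (b : ℝ) ^ N) (ξ, y) + 4 * Real.pi * W := by linarith [t1.1, t2.2]
      have t5 := mul_le_mul_of_nonneg_left t3 gN.le
      have t6 := mul_le_mul_of_nonneg_left t4 gN.le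
      have t7 : (ratio b lam / b) ^ N ≤ ratio b lam ^ N :=
        pow_le_pow_left₀ (by positivity) (div_le_self g0.le hb1) N
      have t8 : (1 + 8 * Real.pi * W) * ratio b lam ^ N ≤ K * ratio b lam ^ N := by gcongr
      constructor
      · linarith [hΘ₀.1]
      · linarith [hΘ₀.2]
  have hlower : ENNReal.ofReal (1 / 2) ≤ volume S := by
    have h1 : (1 : ENNReal) ≤ ENNReal.ofReal (1 / 2) + volume S := by
      calc (1 : ENNReal) = volume (Ico (0 : ℝ) 1) := by simp
        _ ≤ _ := measure_mono hcover
        _ ≤ _ := measure_union_le _ _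
        _ ≤ _ := add_le_add_left hTvol _
    have h2 : (1 : ENNReal) = ENNReal.ofReal (1 / 2) + ENNReal.ofReal (1 / 2) := by
      rw [← ENNReal.ofReal_add (by norm_num) (by norm_num)]; norm_num
    rw [h2] at h1
    exact (ENNReal.add_le_add_iff_left (by simp)).mp h1
  calc _ ≤ ENNReal.ofReal τ := hupper
    _ = 2 * ENNReal.ofReal τ * ENNReal.ofReal (1 / 2) := by
      have : ENNReal.ofReal (1 / 2) = 2⁻¹ := by
        rw [one_div, ENNReal.ofReal_inv_of_pos two_pos]; norm_num
      rw [this, mul_right_comm, ENNReal.mul_inv_cancel (by simp) (by simp), one_mul]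
    _ ≤ _ := mul_le_mul_right hlower _

/-- Passing from scale `γ ^ N` to scale `(γ / b) ^ N`. -/
theorem IsExceptional.next {b : ℕ} (hb : 2 ≤ b) {lam : ℝ} (h : 1 < (b : ℝ) * lam) (N : ℕ)
    {τ M β c : ℝ} (hτ : 0 < τ) (hM : 0 ≤ M) (hc : 0 ≤ c)
    (hpc : pairCorr b lam (thickening b lam * (b : ℝ)⁻¹ ^ N) ≤ ENNReal.ofReal c)
    {E₁ : Set (ℝ × ℝ)} (hE : IsExceptional b lam (ratio b lam ^ N) M β E₁) {K : ℕ}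
    (hK : 1 + 8 * Real.pi * (ratio b lam / (1 - ratio b lam)) ≤ (K + 1 : ℕ)) :
    IsExceptional b lam ((ratio b lam / b) ^ N) (2 * M + c / τ) (2 * τ * ((K + 1 : ℕ) * β))
      (nextExceptional b lam N (thickening b lam * (b : ℝ)⁻¹ ^ N) τ E₁) := by
  have hm : 0 < b ^ N := pow_pos (by omega) N
  have mE := measurableSet_nextExceptional h N (thickening b lam * (b : ℝ)⁻¹ ^ N) τ
    hE.measurableSet
  refine ⟨union_subset inter_subset_left inter_subset_left, mE,
    volume_nextExceptional_le hb h N hτ hM hc hpc hE.measurableSet hE.subset hE.volume_le,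
    fun z hz x hx a => ?_⟩
  have mΘ : ∀ u v : ℝ, MeasurableSet {ξ | Theta b lam z (ξ, x) ∈ Icc u v} := fun u v =>
    ((measurable_Theta h z).comp measurable_prodMk_right) measurableSet_Icc
  set a' := a - 4 * Real.pi * (ratio b lam / (1 - ratio b lam)) * ratio b lam ^ N
  calc _ = _ := volume_eq_sum_cylinders (b ^ N) hm
        ((measurableSet_goodSection mE x).inter (mΘ _ _)) (fun ξ hξ => hξ.1.1)
    _ ≤ ∑ j ∈ Finset.range (b ^ N), ((b ^ N : ℕ) : ENNReal)⁻¹ * (2 * ENNReal.ofReal τ *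
        volume {ξ ∈ Ico (0 : ℝ) 1 | ((j : ℝ) + ξ) / (b ^ N : ℕ) ∈
        goodSection E₁ x ∩ {ξ | Theta b lam z (ξ, x) ∈
          Icc a' (a' + (K + 1 : ℕ) * ratio b lam ^ N)}}) :=
      Finset.sum_le_sum fun j hj => mul_le_mul_right
        (volume_cylinder_le hb h N j (Finset.mem_range.mp hj) hE.measurableSet hK hz hx a) _
    _ = 2 * ENNReal.ofReal τ * volume (goodSection E₁ x ∩ {ξ | Theta b lam z (ξ, x) ∈
          Icc a' (a' + (K + 1 : ℕ) * ratio b lam ^ N)}) := by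
      rw [volume_eq_sum_cylinders (b ^ N) hm (G := goodSection E₁ x ∩ _)
        ((measurableSet_goodSection hE.measurableSet x).inter (mΘ _ _)) (fun ξ hξ => hξ.1.1),
        Finset.mul_sum]
      exact Finset.sum_congr rfl fun j _ => mul_left_comm _ _ _
    _ ≤ 2 * ENNReal.ofReal τ * ((K + 1 : ℕ) * ENNReal.ofReal β) :=
      mul_le_mul_right (volume_inter_Icc_le (f := fun ξ => Theta b lam z (ξ, x))
        (hE.small_ball z hz x hx) K a') _
    _ = _ := by
      rw [ENNReal.ofReal_mul (by positivity), ENNReal.ofReal_mul (by norm_num),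
        ENNReal.ofReal_mul (by positivity), ENNReal.ofReal_natCast]
      norm_num

theorem exists_rpow_eq {q s : ℝ} (hq0 : 0 < q) (hq1 : q < 1) (hs0 : 0 < s) (hs1 : s < 1) :
    ∃ δ : ℝ, 0 < δ ∧ q ^ δ = s := by
  refine ⟨Real.log s / Real.log q, div_pos_of_neg_of_neg (Real.log_neg hs0 hs1)
    (Real.log_neg hq0 hq1), ?_⟩
  rw [Real.rpow_def_of_pos hq0, mul_div_cancel₀ _ (Real.log_neg hq0 hq1).ne, Real.exp_log hs0]

/-- One step of the induction halves the loss, up to an arbitrarily small `ρ`. -/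
theorem HasSmallBalls.step {b : ℕ} (hb : 2 ≤ b) {lam : ℝ} (h : 1 < (b : ℝ) * lam)
    (hlam : lam < 1) (hneg : hFun b lam < 0) {κ ρ : ℝ} (hκ : 0 ≤ κ) (hρ : 0 < ρ)
    (hκρ : κ / 2 + ρ ≤ 1) (H : HasSmallBalls b lam κ) :
    HasSmallBalls b lam (κ / 2 + ρ) := by
  obtain ⟨δ₁, C₁, hδ₁, hC₁, H⟩ := H
  obtain ⟨C₂, hC₂, hpc⟩ := exists_pairCorr_le hb h hlam hneg
  have g0 := ratio_pos h
  have g1 := ratio_lt_one h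
  have q0 := ratio_div_pos hb h
  have q1 := ratio_div_lt_one hb h
  have hb1 : (1 : ℝ) < b := by exact_mod_cast (by omega : 1 < b)
  have hb0 : (0 : ℝ) < b := by linarith
  have binv0 : 0 < (b : ℝ)⁻¹ := by positivity
  have binv1 : (b : ℝ)⁻¹ < 1 := inv_lt_one_of_one_lt₀ hb1
  have hl0 : 0 < lam := by
    by_contra! hl
    nlinarith
  have hbg : (b : ℝ)⁻¹ ≤ ratio b lam := by
    unfold ratio
    rw [← one_div]
    exact one_div_le_one_div_of_le (by positivity) (by nlinarith)
  obtain ⟨K, hK⟩ := exists_nat_ge (1 + 8 * Real.pi * (ratio b lam / (1 - ratio b lam)))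
  have hK' : 1 + 8 * Real.pi * (ratio b lam / (1 - ratio b lam)) ≤ (K + 1 : ℕ) := by
    push_cast; linarith
  have hth : 0 < thickening b lam := by
    have : 0 < 12 * Real.pi ^ 2 / (1 - ratio b lam) := div_pos (by positivity) (by linarith)
    unfold thickening; linarith
  have s1 : ratio b lam ^ δ₁ < 1 := Real.rpow_lt_one g0.le g1 hδ₁
  have s2 : (b : ℝ)⁻¹ ^ ρ < 1 := Real.rpow_lt_one binv0.le binv1 hρ
  obtain ⟨δ, hδ, hδe⟩ := exists_rpow_eq q0 q1
    (lt_max_of_lt_left (by positivity) : 0 < max (ratio b lam ^ δ₁) ((b : ℝ)⁻¹ ^ ρ))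
    (max_lt s1 s2)
  have hswap : ∀ (t e : ℝ) (N : ℕ), 0 < t → (t ^ N) ^ e = (t ^ e) ^ N := fun t e N ht => by
    rw [← Real.rpow_natCast, ← Real.rpow_natCast, ← Real.rpow_mul ht.le, ← Real.rpow_mul ht.le,
      mul_comm]
  refine hasSmallBalls_of_pow (q := ratio b lam / b) hκρ q0 q1 hδ
    (C := 2 * C₁ + C₂ * thickening b lam + 2 * ((K + 1 : ℕ) * C₁)) (by positivity) fun N => ?_
  set X := ratio b lam ^ N with hX
  set Y := (b : ℝ)⁻¹ ^ N with hY
  have X0 : 0 < X := by positivity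
  have X1 : X ≤ 1 := pow_le_one₀ g0.le g1.le
  have Y0 : 0 < Y := by positivity
  have YX : Y ≤ X := pow_le_pow_left₀ binv0.le hbg N
  have hXY : (ratio b lam / b) ^ N = X * Y := by rw [div_eq_mul_inv, mul_pow]
  obtain ⟨E₁, hE₁⟩ := H X X0 X1
  have hτ : 0 < Y ^ (1 - ρ) := by positivity
  have hnext := hE₁.next hb h N hτ (by positivity)
    (c := C₂ * (thickening b lam * Y)) (by positivity) (hpc _ (by positivity)) hK'
  refine ⟨_, hnext.subset, hnext.measurableSet,
    hnext.volume_le.trans (ENNReal.ofReal_le_ofReal ?_), fun z hz x hx a =>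
    (hnext.small_ball z hz x hx a).trans (ENNReal.ofReal_le_ofReal ?_)⟩
  · set P := ((ratio b lam / b) ^ N) ^ δ with hP
    have P0 : 0 < P := by positivity
    have e1 : X ^ δ₁ ≤ P := by
      rw [hP, hX, hswap _ _ _ g0, hswap _ _ _ q0, hδe]
      exact pow_le_pow_left₀ (by positivity) (le_max_left _ _) N
    have e2 : Y ^ ρ ≤ P := by
      rw [hP, hY, hswap _ _ _ binv0, hswap _ _ _ q0, hδe]
      exact pow_le_pow_left₀ (by positivity) (le_max_right _ _) N
    have e3 : C₂ * (thickening b lam * Y) / Y ^ (1 - ρ) = C₂ * thickening b lam * Y ^ ρ := by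
      rw [div_eq_iff hτ.ne', mul_assoc, ← Real.rpow_add Y0]
      rw [show ρ + (1 - ρ) = 1 by ring, Real.rpow_one]; ring
    rw [e3]
    calc 2 * (C₁ * X ^ δ₁) + C₂ * thickening b lam * Y ^ ρ
        ≤ 2 * (C₁ * P) + C₂ * thickening b lam * P := by gcongr
      _ ≤ 2 * (C₁ * P) + C₂ * thickening b lam * P + 2 * ((K + 1 : ℕ) * C₁) * P := by
        have : 0 ≤ 2 * ((K + 1 : ℕ) * C₁) * P := by positivity
        linarith
      _ = _ := by ring
  · rw [hXY]
    -- here `1 / b ≤ γ` enters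
    have key : Y ^ (1 - ρ) * X ^ (1 - κ) ≤ (X * Y) ^ (1 - (κ / 2 + ρ)) := by
      have f1 : Y ^ (1 - ρ) = Y ^ (1 - (κ / 2 + ρ)) * Y ^ (κ / 2) := by
        rw [← Real.rpow_add Y0]; congr 1; ring
      have f2 : X ^ (1 - (κ / 2 + ρ)) = X ^ (1 - κ) * X ^ (κ / 2) * X ^ (-ρ) := by
        rw [← Real.rpow_add X0, ← Real.rpow_add X0]; congr 1; ring
      have f3 : 1 ≤ X ^ (-ρ) := Real.one_le_rpow_of_pos_of_le_one_of_nonpos X0 X1 (by linarith)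
      have f4 : Y ^ (κ / 2) ≤ X ^ (κ / 2) := Real.rpow_le_rpow Y0.le YX (by linarith)
      rw [Real.mul_rpow X0.le Y0.le, f1, f2]
      calc Y ^ (1 - (κ / 2 + ρ)) * Y ^ (κ / 2) * X ^ (1 - κ)
          ≤ Y ^ (1 - (κ / 2 + ρ)) * X ^ (κ / 2) * X ^ (1 - κ) := by gcongr
        _ = X ^ (1 - κ) * X ^ (κ / 2) * 1 * Y ^ (1 - (κ / 2 + ρ)) := by ring
        _ ≤ _ := by gcongr
    calc 2 * Y ^ (1 - ρ) * ((K + 1 : ℕ) * (C₁ * X ^ (1 - κ)))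
        = 2 * ((K + 1 : ℕ) * C₁) * (Y ^ (1 - ρ) * X ^ (1 - κ)) := by ring
      _ ≤ 2 * ((K + 1 : ℕ) * C₁) * (X * Y) ^ (1 - (κ / 2 + ρ)) := by gcongr
      _ ≤ _ := by
        refine mul_le_mul_of_nonneg_right ?_ (by positivity)
        have : 0 ≤ C₂ * thickening b lam := by positivity
        linarith

/-- Small ball estimates with arbitrarily small loss. -/
theorem hasSmallBalls {b : ℕ} (hb : 2 ≤ b) {lam : ℝ} (h : 1 < (b : ℝ) * lam)
    (hlam : lam < 1) (hneg : hFun b lam < 0) {η : ℝ} (hη : 0 < η) (hη1 : η ≤ 1) :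
    ∃ κ : ℝ, κ ≤ η ∧ HasSmallBalls b lam κ := by
  -- the fixed point of the recursion `κ ↦ κ / 2 + η / 4` is `η / 2`
  have claim : ∀ k : ℕ, HasSmallBalls b lam ((1 - η / 2) * (1 / 2) ^ k + η / 2) := by
    intro k
    induction k with
    | zero =>
      convert hasSmallBalls_one b lam using 1
      ring
    | succ k ih =>
      have hp : (1 / 2 : ℝ) ^ k ≤ 1 := pow_le_one₀ (by norm_num) (by norm_num)
      have hp0 : (0 : ℝ) < (1 / 2) ^ k := by positivity
      have := ih.step hb h hlam hneg (ρ := η / 4) (by nlinarith) (by linarith) (by nlinarith)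
      convert this using 1
      rw [pow_succ]; ring
  obtain ⟨k, hk⟩ := exists_pow_lt_of_lt_one (half_pos hη) (by norm_num : (1 / 2 : ℝ) < 1)
  refine ⟨_, ?_, claim k⟩
  have hp0 : (0 : ℝ) < (1 / 2) ^ k := by positivity
  nlinarith

/-! ### Families of intervals -/

/-- Fubini for sections whose end points are measurable, with arbitrary intervals between the open
and the closed one. -/
theorem volume_interval_family_le {b : ℕ} {lam : ℝ} (h : 1 < (b : ℝ) * lam) {z len β : ℝ}
    {E : Set (ℝ × ℝ)} (hE : MeasurableSet E) {L : ℝ → Set ℝ}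
    (hL : IsMeasurableIntervalFamily L len)
    (H : ∀ x ∈ Ico (0 : ℝ) 1, ∀ a : ℝ,
      volume (goodSection E x ∩ {ξ | Theta b lam z (ξ, x) ∈ Icc a (a + len)})
        ≤ ENNReal.ofReal β) :
    volume {p : ℝ × ℝ | p ∈ unitSquare \ E ∧ Theta b lam z p ∈ L p.2} ≤ ENNReal.ofReal β := by
  obtain ⟨a, ha, hLa⟩ := hL
  set a' := ha.mk a
  have ma' : Measurable a' := ha.measurable_mk
  set Z := {x ∈ Ico (0 : ℝ) 1 | a x ≠ a' x} with hZ
  have hZ0 : volume Z = 0 := by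
    have := (ae_restrict_iff' measurableSet_Ico).mp ha.ae_eq_mk
    rw [ae_iff] at this
    convert this using 2
    ext x
    simp [hZ, a', and_assoc]
  set T := {p : ℝ × ℝ | p ∈ unitSquare \ E ∧
    Theta b lam z p ∈ Icc (a' p.2) (a' p.2 + len)} with hT
  have mT : MeasurableSet T := by
    have mΘ := measurable_Theta h z
    have ma2 : Measurable fun p : ℝ × ℝ => a' p.2 := ma'.comp measurable_snd
    exact (measurableSet_unitSquare.diff hE).inter
      ((measurableSet_le ma2 mΘ).inter (measurableSet_le mΘ (ma2.add_const len)))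
  have hsub : {p : ℝ × ℝ | p ∈ unitSquare \ E ∧ Theta b lam z p ∈ L p.2} ⊆ T ∪ univ ×ˢ Z := by
    rintro p ⟨hp, hpL⟩
    by_cases hz : a p.2 = a' p.2
    · refine Or.inl ⟨hp, ?_⟩
      rw [← hz]
      exact (hLa p.2 hp.1.2).2 hpL
    · exact Or.inr ⟨mem_univ _, hp.1.2, hz⟩
  have hZ2 : volume ((univ : Set ℝ) ×ˢ Z) = 0 := by
    rw [Measure.volume_eq_prod, Measure.prod_prod, hZ0, mul_zero]
  refine (measure_mono hsub).trans ((measure_union_le _ _).trans ?_)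
  rw [hZ2, add_zero, Measure.volume_eq_prod, Measure.prod_apply_symm mT]
  have hsec : ∀ x, volume ((fun ξ => (ξ, x)) ⁻¹' T)
      ≤ (Ico (0 : ℝ) 1).indicator (fun _ => ENNReal.ofReal β) x := by
    intro x
    by_cases hx : x ∈ Ico (0 : ℝ) 1
    · rw [indicator_of_mem hx]
      refine le_trans (measure_mono ?_) (H x hx (a' x))
      rintro ξ ⟨⟨h1, h2⟩, h3⟩
      exact ⟨⟨h1.1, h2⟩, h3⟩
    · rw [indicator_of_notMem hx]
      refine le_of_eq (measure_mono_null (t := ∅) ?_ measure_empty)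
      rintro ξ ⟨⟨h1, -⟩, -⟩
      exact hx h1.2
  refine (lintegral_mono hsec).trans ?_
  rw [lintegral_indicator measurableSet_Ico, lintegral_Ico_const]

end Weierstrass

theorem mainTheorem3 (b : ℕ) (hb : 2 ≤ b) (lam : ℝ)
    (hlam : lam ∈ Set.Ioo (Weierstrass.lambdaCrit b hb) 1)
    (η : ℝ) (hη : 0 < η) (hη1 : η ≤ 1) :
    ∃ δ C : ℝ, 0 < δ ∧ δ < η ∧ 0 < C ∧
      ∀ r : ℝ, 0 < r → r < 1 →
        ∃ E : Set (ℝ × ℝ), E ⊆ Weierstrass.unitSquare ∧ MeasurableSet E ∧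
          MeasureTheory.volume E ≤ ENNReal.ofReal (C * r ^ δ) ∧
          ∀ z : ℝ, z ∈ Set.Icc (-1 : ℝ) 1 → z ≠ 0 →
            ∀ L : ℝ → Set ℝ, Weierstrass.IsMeasurableIntervalFamily L (2 * r / |z|) →
              MeasureTheory.volume
                  {p : ℝ × ℝ | p ∈ Weierstrass.unitSquare \ E ∧
                    Weierstrass.Theta b lam z p ∈ L p.2}
                ≤ ENNReal.ofReal (C * r ^ (1 - 2 * η) * |z| ^ (-(1 - η))) := by
  have h := Weierstrass.one_lt_mul_of_lambdaCrit_lt hb hlam.1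
  have hneg := Weierstrass.hFun_neg_of_lambdaCrit_lt hb hlam
  obtain ⟨κ, hκη, δ₀, C₀, hδ₀, hC₀, H⟩ := Weierstrass.hasSmallBalls hb h hlam.2 hneg hη hη1
  refine ⟨min δ₀ (η / 2), 1 + 3 * C₀, by positivity,
    (min_le_right _ _).trans_lt (by linarith), by positivity, fun r hr hr1 => ?_⟩
  obtain ⟨E, hE⟩ := H r hr hr1.le
  refine ⟨E, hE.subset, hE.measurableSet,
    hE.volume_le.trans (ENNReal.ofReal_le_ofReal ?_), fun z hz hz0 L hL =>
    Weierstrass.volume_interval_family_le h hE.measurableSet hL fun x hx a => ?_⟩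
  · have : r ^ δ₀ ≤ r ^ min δ₀ (η / 2) :=
      Real.rpow_le_rpow_of_exponent_ge hr hr1.le (min_le_left _ _)
    gcongr
    linarith
  have hz1 : |z| ≤ 1 := abs_le.mpr ⟨hz.1, hz.2⟩
  have z0 : 0 < |z| := abs_pos.mpr hz0
  rcases lt_or_ge |z| r with hzr | hrz
  · -- the right-hand side is at least one
    calc _ ≤ MeasureTheory.volume (Set.Ico (0 : ℝ) 1) :=
          MeasureTheory.measure_mono fun ξ hξ => hξ.1.1
      _ = ENNReal.ofReal 1 := by simp
      _ ≤ _ := by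
        apply ENNReal.ofReal_le_ofReal
        have e1 : r ^ (1 - 2 * η) = r ^ (1 - η) * r ^ (-η) := by
          rw [← Real.rpow_add hr]; congr 1; ring
        have e2 : 1 ≤ r ^ (-η) :=
          Real.one_le_rpow_of_pos_of_le_one_of_nonpos hr hr1.le (by linarith)
        have e3 : |z| ^ (1 - η) ≤ r ^ (1 - η) :=
          Real.rpow_le_rpow z0.le hzr.le (by linarith)
        have e4 : |z| ^ (1 - η) * |z| ^ (-(1 - η)) = 1 := by
          rw [← Real.rpow_add z0, add_neg_cancel, Real.rpow_zero]
        calc (1 : ℝ) = 1 * (|z| ^ (1 - η) * 1) * |z| ^ (-(1 - η)) := by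
              rw [one_mul, mul_one, e4]
          _ ≤ (1 + 3 * C₀) * (r ^ (1 - η) * r ^ (-η)) * |z| ^ (-(1 - η)) := by
            gcongr
            linarith
          _ = _ := by rw [e1]
  · -- cover the interval by at most `3 / |z|` intervals of length `r`
    set K := ⌊2 / |z|⌋₊
    have k1 : (K : ℝ) ≤ 2 / |z| := Nat.floor_le (by positivity)
    have k2 : 2 / |z| < K + 1 := Nat.lt_floor_add_one _
    have k3 : ((K + 1 : ℕ) : ℝ) ≤ 3 / |z| := by
      have : 1 ≤ 1 / |z| := by rw [le_div_iff₀ z0]; linarith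
      have e : 3 / |z| = 2 / |z| + 1 / |z| := by rw [← add_div]; norm_num
      push_cast; linarith
    calc _ ≤ _ := MeasureTheory.measure_mono (Set.inter_subset_inter_right _ ?_)
      _ ≤ _ := Weierstrass.volume_inter_Icc_le
          (f := fun ξ => Weierstrass.Theta b lam z (ξ, x)) (hE.small_ball z hz1 x hx) K a
      _ = ENNReal.ofReal ((K + 1 : ℕ) * (C₀ * r ^ (1 - κ))) := by
        rw [ENNReal.ofReal_mul (Nat.cast_nonneg _), ENNReal.ofReal_natCast]
      _ ≤ _ := by
        apply ENNReal.ofReal_le_ofReal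
        have e1 : r ^ (1 - κ) ≤ r ^ (1 - 2 * η) * r ^ η := by
          rw [← Real.rpow_add hr]
          exact Real.rpow_le_rpow_of_exponent_ge hr hr1.le (by linarith)
        have e2 : r ^ η ≤ |z| ^ η := Real.rpow_le_rpow hr.le hrz hη.le
        have e3 : |z| ^ η / |z| = |z| ^ (-(1 - η)) := by
          rw [show -(1 - η) = η - 1 by ring, Real.rpow_sub z0, Real.rpow_one]
        calc (K + 1 : ℕ) * (C₀ * r ^ (1 - κ))
            ≤ 3 / |z| * (C₀ * (r ^ (1 - 2 * η) * |z| ^ η)) := by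
              gcongr
              exact e1.trans (by gcongr)
          _ = 3 * C₀ * r ^ (1 - 2 * η) * (|z| ^ η / |z|) := by ring
          _ ≤ (1 + 3 * C₀) * r ^ (1 - 2 * η) * |z| ^ (-(1 - η)) := by
            rw [e3]; gcongr; linarith
    rintro ξ ⟨h1, h2⟩
    refine ⟨h1, h2.trans ?_⟩
    have : 2 * r / |z| = 2 / |z| * r := by ring
    rw [this]
    push_cast
    gcongr
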